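/- **Theorem.** Let $n \ge 0$ and $k \ge 2$ be integers and let $\kappa^+,\kappa^- \in \mathbb{Z}_{\ge 0}^k$ with $\kappa^-_i \le \kappa^+_i$ for all $i$. Let $BPP(\kappa^+,\kappa^-)$ be the bounded-size partition polytope, i.e. the set of all $y \in \mathbb{R}^{k\times n}$ satisfying $$\sum_{i=1}^k y_{ij} = 1 \ (1\le j\le n), \qquad \sum_{j=1}^n y_{ij} \ge \kappa^-_i,\quad \sum_{j=1}^n y_{ij} \le \kappa^+_i \ (1\le i\le k), \qquad y_{ij}\ge 0 \ (1\le i\le k,\ 1\le j\le n).$$ Write this system as $Ay=b$, $By\le d$, where $A,b$ collect the equations and $B,d$ all the inequalities. A *circuit* is a vector $g \in \ker(A)\setminus\{0\}$ with coprime integer components such that the support of $Bg$ is inclusion-minimal among the supports of the vectors $Bx$ with $x \in \ker(A)\setminus\{0\}$. A *circuit walk* is a finite sequence of points of the polytope in which each step has the form $y \mapsto y+\alpha g$ with $g$ a circuit and $\alpha>0$ maximal, in the sense that $y+\beta g$ is infeasible for all $\beta>\alpha$. The *circuit diameter* is the maximum, over all ordered pairs of vertices, of the minimum number of steps of a circuit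 walk from the first vertex to the second (it is $0$ if the polytope is empty). Assume the clusters are indexed so that $\kappa^+_1 \ge \dots \ge \kappa^+_k$, and let $i_1$ be an index minimizing $\kappa^+_i-\kappa^-_i$. If $$\sum_{i=1}^k \kappa^+_i > n+k-2 \qquad\text{and}\qquad \kappa^+_i > \kappa^-_i \ \text{ for all } i \ne i_1,$$ then the circuit diameter of $BPP(\kappa^+,\kappa^-)$ is at most $$\kappa^+_1 + \max\Bigl\{\kappa^+_2,\ \tfrac12\sum_{i\ne i_1}(\kappa^+_i-\kappa^-_i)\Bigr\} + 2(k-2).$$ -/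

import Mathlib

open scoped Matrix

/-- A polyhedral system `A x = b`, `B x ≤ d` over the reals, with variables indexed by `V`,
equations indexed by `E` and inequalities indexed by `I`. -/
structure PolyhedralSystem (V E I : Type*) where
  A : Matrix E V ℝ
  b : E → ℝ
  B : Matrix I V ℝ
  d : I → ℝ

namespace PolyhedralSystem

variable {V E I : Type*} [Fintype V]

/-- The polyhedron `{x | A x = b, B x ≤ d}`. -/
def feasible (P : PolyhedralSystem V E I) : Set (V → ℝ) :=
  {x | P.A *ᵥ x = P.b ∧ P.B *ᵥ x ≤ P.d}

/-- The vertices (extreme points) of the polyhedron. -/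
def vertices (P : PolyhedralSystem V E I) : Set (V → ℝ) :=
  P.feasible.extremePoints ℝ

/-- `g` is a circuit of the system: a nonzero vector of `ker A` with coprime integer components
such that the support of `B g` is inclusion-minimal among the supports of the vectors `B x`,
`x ∈ ker A \ {0}`. -/
def IsCircuit (P : PolyhedralSystem V E I) (g : V → ℝ) : Prop :=
  g ≠ 0 ∧ P.A *ᵥ g = 0 ∧
    (∃ z : V → ℤ, (∀ v, g v = (z v : ℝ)) ∧ Finset.univ.gcd z = 1) ∧
    ∀ x : V → ℝ, x ≠ 0 → P.A *ᵥ x = 0 →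
      Function.support (P.B *ᵥ x) ⊆ Function.support (P.B *ᵥ g) →
      Function.support (P.B *ᵥ x) = Function.support (P.B *ᵥ g)

/-- One circuit step from `x` to `y`: move from the feasible point `x` along a circuit `g`, with
the maximal step length for which the polyhedron is not left. -/
def IsCircuitStep (P : PolyhedralSystem V E I) (x y : V → ℝ) : Prop :=
  x ∈ P.feasible ∧ y ∈ P.feasible ∧
    ∃ g : V → ℝ, P.IsCircuit g ∧ ∃ α : ℝ, 0 < α ∧ y = x + α • g ∧
      ∀ β : ℝ, α < β → x + β • g ∉ P.feasible

/-- There is a circuit walk with exactly `N` steps from `x` to `y`. -/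
def HasCircuitWalk (P : PolyhedralSystem V E I) (x y : V → ℝ) (N : ℕ) : Prop :=
  ∃ w : Fin (N + 1) → V → ℝ, w 0 = x ∧ w (Fin.last N) = y ∧
    ∀ t : Fin N, P.IsCircuitStep (w t.castSucc) (w t.succ)

/-- The circuit distance: the minimum number of steps of a circuit walk from `x` to `y`
(`⊤` if there is none). -/
noncomputable def circuitDist (P : PolyhedralSystem V E I) (x y : V → ℝ) : ℕ∞ :=
  ⨅ N : ℕ, ⨅ _ : P.HasCircuitWalk x y N, (N : ℕ∞)

/-- The circuit diameter: the maximum circuit distance over all ordered pairs of vertices. -/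
noncomputable def circuitDiameter (P : PolyhedralSystem V E I) : ℕ∞ :=
  ⨆ x ∈ P.vertices, ⨆ y ∈ P.vertices, P.circuitDist x y

end PolyhedralSystem

/-- The system defining the bounded-size partition polytope for `n` items, `k` clusters, upper
size bounds `κp` and lower size bounds `κm`; the variable `(i, j)` says whether cluster `i`
receives item `j`. The inequalities are, in this order: lower size bounds, upper size bounds,
nonnegativity. -/
def boundedSizePartitionSystem (n k : ℕ) (κp κm : Fin k → ℕ) :
    PolyhedralSystem (Fin k × Fin n) (Fin n) (Fin k ⊕ Fin k ⊕ Fin k × Fin n) where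
  A := Matrix.of fun j v => if v.2 = j then 1 else 0
  b := fun _ => 1
  B := Matrix.of fun r v =>
    match r with
    | Sum.inl i => if v.1 = i then -1 else 0
    | Sum.inr (Sum.inl i) => if v.1 = i then 1 else 0
    | Sum.inr (Sum.inr u) => if v = u then -1 else 0
  d := fun r =>
    match r with
    | Sum.inl i => -(κm i : ℝ)
    | Sum.inr (Sum.inl i) => (κp i : ℝ)
    | Sum.inr (Sum.inr _) => 0

/-- Sanity check: the polyhedron of the system is the set of solutions of the usual constraints. -/
theorem mem_feasible_boundedSizePartitionSystem {n k : ℕ} {κp κm : Fin k → ℕ}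
    (y : Fin k × Fin n → ℝ) :
    y ∈ (boundedSizePartitionSystem n k κp κm).feasible ↔
      (∀ j, ∑ i, y (i, j) = 1) ∧ (∀ i, (κm i : ℝ) ≤ ∑ j, y (i, j)) ∧
        (∀ i, ∑ j, y (i, j) ≤ (κp i : ℝ)) ∧ ∀ i j, 0 ≤ y (i, j) := by
  simp [PolyhedralSystem.feasible, boundedSizePartitionSystem, funext_iff, Pi.le_def,
    Matrix.mulVec, dotProduct, Fintype.sum_prod_type, ite_mul,
    Prod.ext_iff, ite_and]

/-! Vertices are integral, so they are assignments of items to clusters. Two assignments c and c'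
span a difference graph: each item j with c j ≠ c' j is an arc from c j to c' j. Moving items along
one cycle, or along one path whose ends can absorb the change of size, is a circuit step. Paths
become cycles when they are closed through a slack node.

Let Δ bound all in- and out-degrees, and let the total excess P be at most 2Δ. Loops and two slack
nodes extend the graph to a Δ-regular one, in which Birkhoff's theorem finds a permutation σ: a
layer of disjoint cycles and at most two paths that meets every cluster of degree Δ
(`exists_isLayer`). Carrying out the layer lowers Δ by one and keeps P ≤ 2Δ.

A layer costs only two circuit steps. Multiplying σ by a cycle ρ on representatives of its cycles
merges them into one cycle, and ρ⁻¹ then repairs the diverted items. If there are two paths, the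
first is diverted to the end of the second, and the second step runs the second path and shifts the
surplus item to its proper end. Hence 2Δ steps suffice (`withinSteps_two_mul`). While only one
cluster has degree above Δ, the single cycle of a layer through it is enough, one step per unit
(`withinSteps_two_mul_add`).

Degrees are at most κ⁺, so Δ = max(κ⁺₂, ⌈P/2⌉) works with cluster 1 as the exception, and 2P ≤ ∑(κ⁺
- κ⁻) gives the bound (`steps_le_bound`). -/

section

open Finset

/-! ### Assignments as integral points of the polytope -/

variable {n k : ℕ}

/-- The point of the partition polytope that belongs to an assignment of the items to clusters. -/
def assignmentPoint (c : Fin n → Fin k) : Fin k × Fin n → ℝ :=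
  fun v => if c v.2 = v.1 then 1 else 0

/-- The number of items that an assignment gives to a cluster. -/
def clusterSize (c : Fin n → Fin k) (i : Fin k) : ℕ := #{j | c j = i}

/-- The assignment respects the bounds on the cluster sizes. -/
def IsAdmissible (κp κm : Fin k → ℕ) (c : Fin n → Fin k) : Prop :=
  ∀ i, κm i ≤ clusterSize c i ∧ clusterSize c i ≤ κp i

theorem sum_assignmentPoint (c : Fin n → Fin k) (i : Fin k) :
    ∑ j, assignmentPoint c (i, j) = clusterSize c i := by
  simp [assignmentPoint, clusterSize]

theorem assignmentPoint_mem_feasible {κp κm : Fin k → ℕ} {c : Fin n → Fin k}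
    (hc : IsAdmissible κp κm c) :
    assignmentPoint c ∈ (boundedSizePartitionSystem n k κp κm).feasible := by
  rw [mem_feasible_boundedSizePartitionSystem]
  refine ⟨fun j => by simp [assignmentPoint], fun i => ?_, fun i => ?_, fun i j => ?_⟩
  · rw [sum_assignmentPoint]; exact_mod_cast (hc i).1
  · rw [sum_assignmentPoint]; exact_mod_cast (hc i).2
  · unfold assignmentPoint; split_ifs <;> norm_num

theorem mulVec_A_boundedSizePartitionSystem (κp κm : Fin k → ℕ) (x : Fin k × Fin n → ℝ)
    (j : Fin n) :
    ((boundedSizePartitionSystem n k κp κm).A *ᵥ x) j = ∑ i, x (i, j) := by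
  simp [boundedSizePartitionSystem, Matrix.mulVec, dotProduct, Fintype.sum_prod_type]

theorem mulVec_B_lower (κp κm : Fin k → ℕ) (x : Fin k × Fin n → ℝ) (i : Fin k) :
    ((boundedSizePartitionSystem n k κp κm).B *ᵥ x) (Sum.inl i) = -∑ j, x (i, j) := by
  simp [boundedSizePartitionSystem, Matrix.mulVec, dotProduct, Fintype.sum_prod_type, ite_mul]
  rw [Finset.sum_eq_single i (by simp +contextual) (by simp)]
  simp

theorem mulVec_B_nonneg (κp κm : Fin k → ℕ) (x : Fin k × Fin n → ℝ) (u : Fin k × Fin n) :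
    ((boundedSizePartitionSystem n k κp κm).B *ᵥ x) (Sum.inr (Sum.inr u)) = -x u := by
  simp [boundedSizePartitionSystem, Matrix.mulVec, dotProduct, ite_mul]

/-! ### Moves along a permutation are circuit steps -/

/-- The assignment `c₁` arises from `c` by moving the items of `L` along the permutation `π` of the
clusters, to which two slack nodes are added: they are the places where a sequence of
moves that is not cyclic begins and ends. -/
structure MovesAlong (π : Equiv.Perm (Fin k ⊕ Bool)) (L : Finset (Fin n))
    (c c₁ : Fin n → Fin k) : Prop where
  off : ∀ j ∉ L, c₁ j = c j
  on : ∀ j ∈ L, π (Sum.inl (c j)) = Sum.inl (c₁ j)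
  inj : ∀ j ∈ L, ∀ j' ∈ L, c j = c j' → j = j'
  cover : ∀ v w, π (Sum.inl v) = Sum.inl w → v ≠ w → ∃ j ∈ L, c j = v

namespace MovesAlong

variable {π : Equiv.Perm (Fin k ⊕ Bool)} {L : Finset (Fin n)} {c c₁ : Fin n → Fin k}

theorem mem_of_ne (h : MovesAlong π L c c₁) {j : Fin n} (hj : c₁ j ≠ c j) : j ∈ L := by
  by_contra hL
  exact hj (h.off j hL)

theorem eq_of_source_eq (h : MovesAlong π L c c₁) {j j' : Fin n} (hj : c₁ j ≠ c j)
    (hj' : c₁ j' ≠ c j') (he : c j = c j') : j = j' :=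
  h.inj j (h.mem_of_ne hj) j' (h.mem_of_ne hj') he

theorem eq_of_target_eq (h : MovesAlong π L c c₁) {j j' : Fin n} (hj : c₁ j ≠ c j)
    (hj' : c₁ j' ≠ c j') (he : c₁ j = c₁ j') : j = j' := by
  refine h.eq_of_source_eq hj hj' (Sum.inl_injective (π.injective ?_))
  rw [h.on j (h.mem_of_ne hj), h.on j' (h.mem_of_ne hj'), he]

theorem exists_source (h : MovesAlong π L c c₁) {v w : Fin k}
    (hπ : π (Sum.inl v) = Sum.inl w) (hvw : v ≠ w) : ∃ j, c j = v ∧ c₁ j = w := by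
  obtain ⟨j, hj, rfl⟩ := h.cover v w hπ hvw
  refine ⟨j, rfl, Sum.inl_injective (β := Bool) ?_⟩
  rw [← h.on j hj, hπ]

/-- The flow through a cluster that is entered and left by moved items is preserved. -/
theorem sum_row (h : MovesAlong π L c c₁) {a b : Fin n} (hab : c₁ a = c b) (ha : c₁ a ≠ c a)
    (hb : c₁ b ≠ c b) {x : Fin k × Fin n → ℝ}
    (hx : ∀ i j, assignmentPoint c₁ (i, j) = assignmentPoint c (i, j) → x (i, j) = 0) :
    ∑ j, x (c b, j) = x (c b, a) + x (c b, b) := by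
  have hne : a ≠ b := by rintro rfl; exact ha hab
  rw [Finset.sum_eq_add a b hne (fun j _ hj => ?_) (by simp) (by simp)]
  apply hx
  by_cases hm : c₁ j = c j
  · simp [assignmentPoint, hm]
  · have h1 : c j ≠ c b := fun he => hj.2 (h.eq_of_source_eq hm hb he)
    have h2 : c₁ j ≠ c b := fun he => hj.1 (h.eq_of_target_eq hm ha (he.trans hab.symm))
    simp [assignmentPoint, h1, h2]

end MovesAlong

/-- Induction along the orbit of `e`. The step that returns to `e` need not preserve `p`, so a
property may break where the cycle closes, for instance at a slack node. -/
theorem Equiv.Perm.mem_of_sameCycle_of_closed {α : Type*} [Finite α] {f : Equiv.Perm α} {e x : α}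
    {p : α → Prop} (he : p e) (hp : ∀ y, f.SameCycle e y → p y → f y ≠ e → p (f y))
    (hx : f.SameCycle e x) : p x := by
  obtain ⟨i, -, rfl⟩ := hx.exists_pow_eq'
  clear hx
  induction i with
  | zero => simpa using he
  | succ i ih =>
    by_cases h : (f ^ (i + 1)) e = e
    · rwa [h]
    · rw [pow_succ', Equiv.Perm.mul_apply] at h ⊢
      exact hp _ ⟨i, by simp⟩ ih h

/-- For minimality, let the support of `B x` lie in that of `B g`. Then `x` vanishes where `g` does,
column sums make the two entries of a moved item opposite, and a cluster that is entered and left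
has row sum zero for `g`, hence for `x`. So consecutive arcs carry the same value. The moves form
one cycle with at most one slack node, so this value reaches all arcs and `x` is a multiple of `g`.
-/
theorem MovesAlong.isCircuit {π : Equiv.Perm (Fin k ⊕ Bool)} {L : Finset (Fin n)}
    {c c₁ : Fin n → Fin k} (h : MovesAlong π L c c₁) (κp κm : Fin k → ℕ) (hne : c₁ ≠ c)
    (hcyc : ∀ x y, π x ≠ x → π y ≠ y → π.SameCycle x y)
    (hslack : ∃ u, π (Sum.inr u) = Sum.inr u) :
    (boundedSizePartitionSystem n k κp κm).IsCircuit (assignmentPoint c₁ - assignmentPoint c) := by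
  obtain ⟨j₀, hj₀⟩ := Function.ne_iff.1 hne
  have hval : (assignmentPoint c₁ - assignmentPoint c) (c₁ j₀, j₀) = 1 := by
    simp [assignmentPoint, hj₀.symm]
  refine ⟨fun h0 => by rw [h0] at hval; simp at hval, ?_, ⟨fun v => (if c₁ v.2 = v.1 then 1 else 0) -
    (if c v.2 = v.1 then 1 else 0), fun v => ?_, ?_⟩, ?_⟩
  · funext j
    rw [mulVec_A_boundedSizePartitionSystem]
    simp [assignmentPoint]
  · simp [assignmentPoint]
  · have hd : Finset.univ.gcd (fun v : Fin k × Fin n => (if c₁ v.2 = v.1 then (1 : ℤ) else 0) -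
        (if c v.2 = v.1 then 1 else 0)) ∣ 1 := by
      refine (Finset.gcd_dvd (mem_univ (c₁ j₀, j₀))).trans ?_
      simp [hj₀.symm]
    rw [← Finset.normalize_gcd, normalize_eq_one]
    exact isUnit_of_dvd_one hd
  intro x hx0 hxA hsupp
  have hxe : ∀ i j, assignmentPoint c₁ (i, j) = assignmentPoint c (i, j) → x (i, j) = 0 := by
    intro i j hij
    by_contra hxi
    have := @hsupp (Sum.inr (Sum.inr (i, j))) (by simpa [mulVec_B_nonneg] using hxi)
    simp [mulVec_B_nonneg, hij] at this
  have hcol : ∀ j, c₁ j ≠ c j → x (c j, j) = -x (c₁ j, j) := by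
    intro j hj
    have h1 : ∑ i, x (i, j) = 0 := by
      rw [← mulVec_A_boundedSizePartitionSystem κp κm, hxA]; rfl
    rw [Finset.sum_eq_add (c j) (c₁ j) hj.symm (fun i _ hi => hxe i j
      (by simp [assignmentPoint, hi.1.symm, hi.2.symm])) (by simp) (by simp)] at h1
    linarith
  have hflow : ∀ a b, c₁ a ≠ c a → c₁ b ≠ c b → c₁ a = c b → x (c₁ b, b) = x (c₁ a, a) := by
    intro a b ha hb hab
    have hg := h.sum_row hab ha hb (x := assignmentPoint c₁ - assignmentPoint c)
      (fun i j hij => by simp [hij])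
    have hab' : c a ≠ c b := by rw [← hab]; exact ha.symm
    have hg0 : ∑ j, (assignmentPoint c₁ - assignmentPoint c) (c b, j) = 0 := by
      rw [hg]; simp [assignmentPoint, hab, hb, hab']
    have hx1 : ∑ j, x (c b, j) = 0 := by
      by_contra hxi
      have := @hsupp (Sum.inl (c b)) (by simpa [mulVec_B_lower] using hxi)
      rw [Function.mem_support, mulVec_B_lower, hg0] at this
      simp at this
    rw [h.sum_row hab ha hb hxe, hcol b hb, ← hab] at hx1
    linarith
  -- a starting point of the cycle that is met before any slack node is passed
  obtain ⟨e, j₁, hj₁, hj₁e, he⟩ : ∃ (e : Fin k ⊕ Bool) (j₁ : Fin n), c₁ j₁ ≠ c j₁ ∧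
      (π.SameCycle e (Sum.inl (c j₁))) ∧ ((∃ j, c₁ j ≠ c j ∧ Sum.inl (c j) = e) →
        Sum.inl (c j₁) = e) ∧ ∀ u, π (Sum.inr u) ≠ Sum.inr u → π (Sum.inr u) = e := by
    have hmv : ∀ j, c₁ j ≠ c j → π (Sum.inl (c j)) ≠ Sum.inl (c j) := by
      intro j hj; rw [h.on j (h.mem_of_ne hj)]; simpa using hj
    by_cases hs : ∃ u, π (Sum.inr u) ≠ Sum.inr u
    · obtain ⟨u, hu⟩ := hs
      have hu' : ∀ u', π (Sum.inr u') ≠ Sum.inr u' → u' = u := by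
        obtain ⟨w, hw⟩ := hslack
        intro u' hu'
        have h1 : u ≠ w := by rintro rfl; exact hu hw
        have h2 : u' ≠ w := by rintro rfl; exact hu' hw
        revert h1 h2; cases u <;> cases u' <;> cases w <;> simp
      have hall : ∀ u', π (Sum.inr u') ≠ Sum.inr u' → π (Sum.inr u') = π (Sum.inr u) :=
        fun u' h' => by rw [hu' u' h']
      have hs : ∀ j, c₁ j ≠ c j → π.SameCycle (π (Sum.inr u)) (Sum.inl (c j)) := fun j hj =>
        hcyc _ _ (fun h => hu (π.injective h)) (hmv j hj)
      by_cases hex : ∃ j, c₁ j ≠ c j ∧ Sum.inl (c j) = π (Sum.inr u)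
      · obtain ⟨j, hj, hje⟩ := hex
        exact ⟨_, j, hj, hs j hj, fun _ => hje, hall⟩
      · exact ⟨_, j₀, hj₀, hs j₀ hj₀, fun h => (hex h).elim, hall⟩
    · push Not at hs
      exact ⟨Sum.inl (c j₀), j₀, hj₀, .refl _ _, fun _ => rfl, fun u hu => (hu (hs u)).elim⟩
  have hconst : ∀ j, c₁ j ≠ c j → x (c₁ j, j) = x (c₁ j₁, j₁) := by
    have hmv : ∀ j, c₁ j ≠ c j → π (Sum.inl (c j)) ≠ Sum.inl (c j) := by
      intro j hj; rw [h.on j (h.mem_of_ne hj)]; simpa using hj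
    intro j hj
    have hp := Equiv.Perm.mem_of_sameCycle_of_closed (f := π) (e := e) (x := Sum.inl (c j))
      (p := fun y => ∀ j, c₁ j ≠ c j → Sum.inl (c j) = y → x (c₁ j, j) = x (c₁ j₁, j₁))
      ?_ ?_ (hj₁e.trans (hcyc _ _ (hmv j₁ hj₁) (hmv j hj)))
    · exact hp j hj rfl
    · intro j hj hje
      have h1 := he.1 ⟨j, hj, hje⟩
      rw [h.eq_of_source_eq hj hj₁ (Sum.inl_injective (hje.trans h1.symm))]
    · intro y _ hy hye j' hj' hj'y
      rcases y with v | u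
      · have hv : v ≠ c j' := by
          rintro rfl
          exact hmv j' hj' hj'y.symm
        obtain ⟨j, rfl, hjj⟩ := h.exists_source hj'y.symm hv
        have hm : c₁ j ≠ c j := by rw [hjj]; exact hv.symm
        rw [hflow j j' hm hj' hjj, hy j hm rfl]
      · exact (hye (he.2 u (by rw [← hj'y]; simp))).elim
  have hxg : x = x (c₁ j₁, j₁) • (assignmentPoint c₁ - assignmentPoint c) := by
    funext ⟨i, j⟩
    by_cases hj : c₁ j = c j
    · have h0 : assignmentPoint c₁ (i, j) = assignmentPoint c (i, j) := by
        simp [assignmentPoint, hj]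
      simp [hxe i j h0, h0]
    · by_cases h1 : c₁ j = i
      · subst h1
        simp [assignmentPoint, Ne.symm hj, hconst j hj]
      · by_cases h2 : c j = i
        · subst h2
          simp [assignmentPoint, hj, hconst j hj, hcol j hj]
        · have h0 : assignmentPoint c₁ (i, j) = assignmentPoint c (i, j) := by
            simp [assignmentPoint, h1, h2]
          simp [hxe i j h0, h0]
  have hl : x (c₁ j₁, j₁) ≠ 0 := fun h0 => hx0 (by rw [hxg, h0, zero_smul])
  conv_lhs => rw [hxg, Matrix.mulVec_smul]
  exact Function.support_const_smul_of_ne_zero _ _ hl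

/-- Step length 1 is maximal because a moved item leaves its cluster entirely: beyond 1 its old
entry `1 - β` is negative. -/
theorem MovesAlong.isCircuitStep {π : Equiv.Perm (Fin k ⊕ Bool)} {L : Finset (Fin n)}
    {c c₁ : Fin n → Fin k} (h : MovesAlong π L c c₁) {κp κm : Fin k → ℕ} (hne : c₁ ≠ c)
    (hcyc : ∀ x y, π x ≠ x → π y ≠ y → π.SameCycle x y)
    (hslack : ∃ u, π (Sum.inr u) = Sum.inr u) (hc : IsAdmissible κp κm c)
    (hc₁ : IsAdmissible κp κm c₁) :
    (boundedSizePartitionSystem n k κp κm).IsCircuitStep (assignmentPoint c)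
      (assignmentPoint c₁) := by
  refine ⟨assignmentPoint_mem_feasible hc, assignmentPoint_mem_feasible hc₁, _,
    h.isCircuit κp κm hne hcyc hslack, 1, one_pos, by simp, fun β hβ hf => ?_⟩
  obtain ⟨j, hj⟩ := Function.ne_iff.1 hne
  have h0 := ((mem_feasible_boundedSizePartitionSystem _).1 hf).2.2.2 (c j) j
  simp only [Pi.add_apply, Pi.smul_apply, Pi.sub_apply, assignmentPoint, hj, if_true, if_false,
    smul_eq_mul] at h0
  linarith

namespace MovesAlong

variable {π : Equiv.Perm (Fin k ⊕ Bool)} {L : Finset (Fin n)} {c c₁ : Fin n → Fin k}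

theorem symm (h : MovesAlong π L c c₁) : MovesAlong π⁻¹ L c₁ c where
  off j hj := (h.off j hj).symm
  on j hj := by rw [Equiv.Perm.inv_eq_iff_eq, h.on j hj]
  inj j hj j' hj' he := h.inj j hj j' hj' (Sum.inl_injective (π.injective (by
    rw [h.on j hj, h.on j' hj', he])))
  cover v w hvw hne := by
    have h1 : π (Sum.inl w) = Sum.inl v := (Equiv.Perm.inv_eq_iff_eq.1 hvw).symm
    obtain ⟨j, hj, rfl⟩ := h.cover w v h1 hne.symm
    exact ⟨j, hj, Sum.inl_injective ((h.on j hj).symm.trans h1)⟩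

/-- The items that enter a cluster and those that leave it determine its new size. -/
theorem clusterSize_add (c c₁ : Fin n → Fin k) (i : Fin k) :
    clusterSize c₁ i + #{j | c₁ j ≠ c j ∧ c j = i} =
      clusterSize c i + #{j | c₁ j ≠ c j ∧ c₁ j = i} := by
  have h1 : clusterSize c₁ i = #{j | c₁ j = i ∧ c j = i} + #{j | c₁ j ≠ c j ∧ c₁ j = i} := by
    rw [clusterSize, ← Finset.card_union_of_disjoint]
    · congr 1; ext j; simp; grind
    · rw [Finset.disjoint_left]; intro j; simp; grind
  have h2 : clusterSize c i = #{j | c₁ j = i ∧ c j = i} + #{j | c₁ j ≠ c j ∧ c j = i} := by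
    rw [clusterSize, ← Finset.card_union_of_disjoint]
    · congr 1; ext j; simp; grind
    · rw [Finset.disjoint_left]; intro j; simp; grind
  omega

theorem card_target_le (h : MovesAlong π L c c₁) (i : Fin k) :
    #{j | c₁ j ≠ c j ∧ c₁ j = i} ≤ 1 := by
  rw [Finset.card_le_one]
  simp only [Finset.mem_filter, Finset.mem_univ, true_and]
  rintro a ⟨ha, rfl⟩ b ⟨hb, hab⟩
  exact h.eq_of_target_eq ha hb hab.symm

theorem card_source_pos (h : MovesAlong π L c c₁) {i w : Fin k}
    (hi : π (Sum.inl i) = Sum.inl w) (hw : i ≠ w) : 0 < #{j | c₁ j ≠ c j ∧ c j = i} := by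
  obtain ⟨j, rfl, hj⟩ := h.exists_source hi hw
  exact Finset.card_pos.2 ⟨j, by simp [hj, hw.symm]⟩

theorem card_target_eq_zero (h : MovesAlong π L c c₁) {i : Fin k}
    (hi : π (Sum.inl i) = Sum.inl i) : #{j | c₁ j ≠ c j ∧ c₁ j = i} = 0 := by
  rw [Finset.card_eq_zero, Finset.filter_eq_empty_iff]
  rintro j - ⟨hj, rfl⟩
  have := h.on j (h.mem_of_ne hj)
  rw [← hi] at this
  exact hj (Sum.inl_injective (π.injective this)).symm

theorem clusterSize_le_add_one (h : MovesAlong π L c c₁) (i : Fin k) :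
    clusterSize c₁ i ≤ clusterSize c i + 1 := by
  have := clusterSize_add c c₁ i
  have := h.card_target_le i
  omega

theorem clusterSize_le (h : MovesAlong π L c c₁) {i w : Fin k} (hi : π (Sum.inl i) = Sum.inl w) :
    clusterSize c₁ i ≤ clusterSize c i := by
  have h1 := clusterSize_add c c₁ i
  have h2 := h.card_target_le i
  by_cases hw : i = w
  · subst hw
    have := h.card_target_eq_zero hi
    omega
  · have := h.card_source_pos hi hw
    omega

/-- The sizes stay within the bounds if a cluster where the moves end has room for one more item
and a cluster where they begin can spare one. -/
theorem isAdmissible (h : MovesAlong π L c c₁) {κp κm : Fin k → ℕ} (hc : IsAdmissible κp κm c)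
    (hend : ∀ i u, π (Sum.inl i) = Sum.inr u → clusterSize c i < κp i)
    (hstart : ∀ i u, π (Sum.inr u) = Sum.inl i → κm i < clusterSize c i) :
    IsAdmissible κp κm c₁ := by
  intro i
  constructor
  -- The lower bound is the argument for the upper bound, applied to the reversed moves.
  · rcases hi : π⁻¹ (Sum.inl i) with w | u
    · exact (hc i).1.trans (h.symm.clusterSize_le hi)
    · have h1 := hstart i u (Equiv.Perm.inv_eq_iff_eq.1 hi).symm
      have h2 := h.symm.clusterSize_le_add_one i
      omega
  · rcases hi : π (Sum.inl i) with w | u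
    · exact (h.clusterSize_le hi).trans (hc i).2
    · have h1 := hend i u hi
      have h2 := h.clusterSize_le_add_one i
      omega

end MovesAlong

/-! ### Integrality of the vertices -/

/-- Numbers in `[0, 1]` with an integral sum are integral or at least two of them are not. -/
theorem two_le_card_of_sum_eq_natCast {ι : Type*} [Fintype ι] [DecidableEq ι] {f : ι → ℝ} {m : ℕ}
    (h0 : ∀ a, 0 ≤ f a) (h1 : ∀ a, f a ≤ 1) (hm : ∑ a, f a = m) {a : ι}
    (ha0 : f a ≠ 0) (ha1 : f a ≠ 1) : 2 ≤ #{b | f b ≠ 0 ∧ f b ≠ 1} := by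
  by_contra hlt
  have hle : #{b | f b ≠ 0 ∧ f b ≠ 1} ≤ 1 := by omega
  rw [Finset.card_le_one] at hle
  have hint : ∀ b ≠ a, f b = ((if f b = 1 then 1 else 0 : ℕ) : ℝ) := by
    intro b hb
    by_cases hb1 : f b = 1
    · simp [hb1]
    · have : f b = 0 := by
        by_contra hb0
        exact hb (hle b (by simp [hb0, hb1]) a (by simp [ha0, ha1]))
      simp [this]
  rw [← Finset.add_sum_erase _ _ (mem_univ a),
    Finset.sum_congr rfl (fun b hb => hint b (Finset.ne_of_mem_erase hb)), ← Nat.cast_sum] at hm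
  have hpos := lt_of_le_of_ne (h0 a) ha0.symm
  have hlt1 := lt_of_le_of_ne (h1 a) ha1
  -- The other terms sum to the integer `N`, and `f a` would place `m` strictly between `N` and `N +
  -- 1`.
  set N := ∑ b ∈ univ.erase a, if f b = 1 then 1 else 0
  have h2 : (N : ℝ) < m := by linarith
  have h3 : (m : ℝ) < N + 1 := by linarith
  have h2' : N < m := by exact_mod_cast h2
  have h3' : m < N + 1 := by exact_mod_cast h3
  omega

/-- A matrix with entries in `[0, 1]` and integral column sums that is not integral can be
perturbed in its fractional entries without a change in the integral row sums and the column
sums. -/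
theorem exists_perturbation {R C : Type*} [Fintype R] [Fintype C] [DecidableEq R] [DecidableEq C]
    {y : R × C → ℝ} (h0 : ∀ v, 0 ≤ y v) (h1 : ∀ v, y v ≤ 1)
    (hcol : ∀ j, ∃ m : ℕ, ∑ i, y (i, j) = m) {v₀ : R × C} (hv₀ : y v₀ ≠ 0 ∧ y v₀ ≠ 1) :
    ∃ g : R × C → ℝ, g ≠ 0 ∧ (∀ v, y v = 0 ∨ y v = 1 → g v = 0) ∧ (∀ j, ∑ i, g (i, j) = 0) ∧
      ∀ i, (∃ m : ℕ, ∑ j, y (i, j) = m) → ∑ j, g (i, j) = 0 := by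
  classical
  let F : Finset (R × C) := {v | y v ≠ 0 ∧ y v ≠ 1}
  let CF : Finset C := F.image Prod.snd
  let RF : Finset R := F.image Prod.fst
  let RI : Finset R := {i ∈ RF | ∃ m : ℕ, ∑ j, y (i, j) = m}
  have hF : ∀ v, v ∈ F ↔ y v ≠ 0 ∧ y v ≠ 1 := fun v => by simp [F]
  have hcardC : 2 * #CF ≤ #F := by
    refine Finset.mul_card_image_le_card (f := Prod.snd) F 2 fun j hj => ?_
    obtain ⟨⟨i, j⟩, hij, rfl⟩ := Finset.mem_image.1 hj
    obtain ⟨m, hm⟩ := hcol j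
    have hij' := (hF _).1 hij
    refine (two_le_card_of_sum_eq_natCast (fun i => h0 (i, j)) (fun i => h1 (i, j)) hm
      hij'.1 hij'.2).trans (Finset.card_le_card_of_injOn (fun i => (i, j)) (fun b hb => ?_)
      fun _ _ _ _ h => (Prod.ext_iff.1 h).1)
    simpa [hF] using hb
  have hcardR : #RF + #RI ≤ #F := by
    have hRI : #RI = ∑ i ∈ RF, if i ∈ RI then 1 else 0 := by
      rw [Finset.sum_ite_mem, Finset.inter_eq_right.2 (Finset.filter_subset _ _),
        Finset.card_eq_sum_ones]
    rw [Finset.card_eq_sum_card_image Prod.fst F, Finset.card_eq_sum_ones RF, hRI,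
      ← Finset.sum_add_distrib]
    refine Finset.sum_le_sum fun i hi => ?_
    obtain ⟨⟨i, j⟩, hij, rfl⟩ := Finset.mem_image.1 hi
    split_ifs with hiI
    · obtain ⟨m, hm⟩ := (Finset.mem_filter.1 hiI).2
      have hij' := (hF _).1 hij
      refine (two_le_card_of_sum_eq_natCast (fun j => h0 (i, j)) (fun j => h1 (i, j)) hm
        hij'.1 hij'.2).trans (Finset.card_le_card_of_injOn (fun j => (i, j)) (fun b hb => ?_)
        fun _ _ _ _ h => (Prod.ext_iff.1 h).2)
      simpa [hF] using hb
    · exact Finset.card_pos.2 ⟨(i, j), by simp [hij]⟩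
  -- `Φ` collects what the perturbation must annihilate. The two counts give `#CF + #RI ≤ #F`, so
  -- there are at most as many conditions as entries, and only a bijective `Φ` would leave no
  -- perturbation.
  let Φ : (R × C → ℝ) →ₗ[ℝ] ((Fᶜ : Finset (R × C)) ⊕ CF ⊕ RI → ℝ) := LinearMap.pi fun r =>
    match r with
    | Sum.inl v => LinearMap.proj v.1
    | Sum.inr (Sum.inl j) => ∑ i, LinearMap.proj (i, j.1)
    | Sum.inr (Sum.inr i) => ∑ j, LinearMap.proj (i.1, j)
  have hΦ1 : ∀ g v, Φ g (Sum.inl v) = g v.1 := fun g v => rfl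
  have hΦ2 : ∀ g j, Φ g (Sum.inr (Sum.inl j)) = ∑ i, g (i, j.1) := fun g j => by simp [Φ]
  have hΦ3 : ∀ g i, Φ g (Sum.inr (Sum.inr i)) = ∑ j, g (i.1, j) := fun g i => by simp [Φ]
  by_cases hinj : Function.Injective Φ
  · exfalso
    have hdim := LinearMap.finrank_le_finrank_of_injective hinj
    have hcF := Finset.card_compl_add_card F
    have hRI : #RI ≤ #RF := Finset.card_le_card (Finset.filter_subset _ _)
    simp only [Module.finrank_fintype_fun_eq_card, Fintype.card_sum, Fintype.card_coe] at hdim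
    have hRR : RI = RF := Finset.eq_of_subset_of_card_le (Finset.filter_subset _ _) (by omega)
    have hsurj : Function.Surjective Φ := by
      refine (LinearMap.injective_iff_surjective_of_finrank_eq_finrank ?_).1 hinj
      simp only [Module.finrank_fintype_fun_eq_card, Fintype.card_sum, Fintype.card_coe]
      omega
    -- In the bijective case every row that meets `F` is integral, so all rows carry a condition.
    -- Row sums 0 together with column sums 1 on `CF` contradict double counting.
    obtain ⟨g, hg⟩ := hsurj fun r => match r with
      | Sum.inl _ => 0
      | Sum.inr (Sum.inl _) => 1
      | Sum.inr (Sum.inr _) => 0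
    have hgF : ∀ v ∉ F, g v = 0 := fun v hv => by
      rw [← hΦ1 g ⟨v, by simpa using hv⟩, hg]
    have hr : ∀ i, ∑ j, g (i, j) = 0 := by
      intro i
      by_cases hi : i ∈ RI
      · rw [← hΦ3 g ⟨i, hi⟩, hg]
      · refine Finset.sum_eq_zero fun j _ => hgF _ fun hj => hi ?_
        rw [hRR]
        exact Finset.mem_image_of_mem Prod.fst hj
    have hc : ∀ j, ∑ i, g (i, j) = if j ∈ CF then 1 else 0 := by
      intro j
      split_ifs with hj
      · rw [← hΦ2 g ⟨j, hj⟩, hg]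
      · refine Finset.sum_eq_zero fun i _ => hgF _ fun hi => hj ?_
        exact Finset.mem_image_of_mem Prod.snd hi
    have htot : ∑ j, ∑ i, g (i, j) = 0 := by
      rw [Finset.sum_comm]
      exact Finset.sum_eq_zero fun i _ => hr i
    rw [Finset.sum_congr rfl fun j _ => hc j, Finset.sum_ite_mem, Finset.univ_inter,
      Finset.sum_const, nsmul_one, Nat.cast_eq_zero, Finset.card_eq_zero] at htot
    have := Finset.mem_image_of_mem Prod.snd ((hF _).2 hv₀)
    rw [show F.image Prod.snd = ∅ from htot] at this
    simp at this
  · rw [← LinearMap.ker_eq_bot, Submodule.eq_bot_iff] at hinj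
    push Not at hinj
    obtain ⟨g, hg, hg0⟩ := hinj
    rw [LinearMap.mem_ker] at hg
    have hgF : ∀ v ∉ F, g v = 0 := fun v hv => by
      rw [← hΦ1 g ⟨v, by simpa using hv⟩, hg]; rfl
    refine ⟨g, hg0, fun v hv => hgF v ?_, fun j => ?_, fun i hi => ?_⟩
    · rw [hF]; tauto
    · by_cases hj : j ∈ CF
      · rw [← hΦ2 g ⟨j, hj⟩, hg]; rfl
      · exact Finset.sum_eq_zero fun i _ => hgF _ fun hi =>
          hj (Finset.mem_image_of_mem Prod.snd hi)
    · by_cases hiF : i ∈ RF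
      · rw [← hΦ3 g ⟨i, by simpa [RI, hiF] using hi⟩, hg]; rfl
      · exact Finset.sum_eq_zero fun j _ => hgF _ fun hj =>
          hiF (Finset.mem_image_of_mem Prod.fst hj)

/-- The size bounds are integers, so a tight one has an integral row sum, which the perturbation `g`
of a fractional point preserves. All other size bounds and nonzero entries have room, so `y + ε • g`
and `y - ε • g` are both feasible for small `ε`. -/
theorem entries_of_mem_vertices {κp κm : Fin k → ℕ} {y : Fin k × Fin n → ℝ}
    (hy : y ∈ (boundedSizePartitionSystem n k κp κm).vertices) (v : Fin k × Fin n) :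
    y v = 0 ∨ y v = 1 := by
  by_contra hv
  push Not at hv
  obtain ⟨hyf, hext⟩ := hy
  obtain ⟨hc, hl, hu, h0⟩ := (mem_feasible_boundedSizePartitionSystem y).1 hyf
  obtain ⟨g, hg0, hgF, hgc, hgr⟩ := exists_perturbation (y := y) (fun v => h0 v.1 v.2)
    (fun v => by
      rw [← hc v.2]
      exact Finset.single_le_sum (f := fun i => y (i, v.2)) (fun i _ => h0 i v.2) (mem_univ v.1))
    (fun j => ⟨1, by simp [hc j]⟩) hv
  have hev : ∀ᶠ ε in nhds (0 : ℝ), y + ε • g ∈ (boundedSizePartitionSystem n k κp κm).feasible := by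
    have hlin : ∀ (a b : ℝ), Filter.Tendsto (fun ε : ℝ => a + ε * b) (nhds 0) (nhds a) := by
      intro a b
      have : Continuous fun ε : ℝ => a + ε * b := by fun_prop
      simpa using this.tendsto 0
    have hrow : ∀ (ε : ℝ) i, ∑ j, (y + ε • g) (i, j) = ∑ j, y (i, j) + ε * ∑ j, g (i, j) := by
      intro ε i
      simp [Finset.sum_add_distrib, Finset.mul_sum]
    simp only [mem_feasible_boundedSizePartitionSystem, hrow, Filter.eventually_and,
      Filter.eventually_all]
    refine ⟨fun j => Filter.Eventually.of_forall fun ε => ?_, fun i => ?_, fun i => ?_,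
      fun i j => ?_⟩
    · simp [Finset.sum_add_distrib, ← Finset.mul_sum, hc j, hgc j]
    · by_cases hi : ∃ m : ℕ, ∑ j, y (i, j) = m
      · simp [hgr i hi, hl i]
      · refine ((hlin _ _).eventually (lt_mem_nhds ?_)).mono fun ε => le_of_lt
        exact lt_of_le_of_ne (hl i) fun h => hi ⟨_, h.symm⟩
    · by_cases hi : ∃ m : ℕ, ∑ j, y (i, j) = m
      · simp [hgr i hi, hu i]
      · refine ((hlin _ _).eventually (gt_mem_nhds ?_)).mono fun ε => le_of_lt
        exact lt_of_le_of_ne (hu i) fun h => hi ⟨_, h⟩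
    · by_cases hz : y (i, j) = 0
      · simp [hz, hgF (i, j) (Or.inl hz)]
      · refine ((hlin _ _).eventually (lt_mem_nhds ?_)).mono fun ε => le_of_lt
        exact lt_of_le_of_ne (h0 i j) (Ne.symm hz)
  have hev' : ∀ᶠ ε in nhds (0 : ℝ),
      y + (-ε) • g ∈ (boundedSizePartitionSystem n k κp κm).feasible := by
    have : Filter.Tendsto (fun ε : ℝ => -ε) (nhds 0) (nhds 0) := by
      simpa using (continuous_neg (G := ℝ)).tendsto 0
    exact this.eventually hev
  obtain ⟨ε, ⟨h1, h2⟩, hε⟩ := (((hev.and hev').filter_mono nhdsWithin_le_nhds).and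
    (self_mem_nhdsWithin (s := {(0 : ℝ)}ᶜ))).exists
  have := hext h1 h2 ⟨1 / 2, 1 / 2, by norm_num, by norm_num, by norm_num, by
    funext v; simp; ring⟩
  have hz : ε • g = 0 := by simpa using this
  rcases smul_eq_zero.1 hz with h | h
  · exact hε h
  · exact hg0 h

/-- The vertices of the partition polytope are integral. -/
theorem exists_assignment_of_mem_vertices {κp κm : Fin k → ℕ} {y : Fin k × Fin n → ℝ}
    (hy : y ∈ (boundedSizePartitionSystem n k κp κm).vertices) :
    ∃ c : Fin n → Fin k, IsAdmissible κp κm c ∧ y = assignmentPoint c := by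
  have h01 := entries_of_mem_vertices hy
  obtain ⟨hc, hl, hu, -⟩ := (mem_feasible_boundedSizePartitionSystem y).1 hy.1
  have hex : ∀ j, ∃ i, y (i, j) = 1 := by
    intro j
    by_contra h
    push Not at h
    have := hc j
    rw [Finset.sum_eq_zero fun i _ => (h01 (i, j)).resolve_right (h i)] at this
    exact zero_ne_one this
  choose c hcj using hex
  have hyc : y = assignmentPoint c := by
    funext ⟨i, j⟩
    by_cases hi : c j = i
    · subst hi
      simp [assignmentPoint, hcj]
    · have h1 := hc j
      rw [← Finset.add_sum_erase _ _ (mem_univ (c j)), hcj, add_eq_left,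
        Finset.sum_eq_zero_iff_of_nonneg fun i _ => by
          rcases h01 (i, j) with h | h <;> simp [h]] at h1
      rw [h1 i (by simp [Ne.symm hi])]
      simp [assignmentPoint, hi]
  refine ⟨c, fun i => ?_, hyc⟩
  have h1 := hl i
  have h2 := hu i
  rw [hyc, sum_assignmentPoint] at h1 h2
  exact ⟨by exact_mod_cast h1, by exact_mod_cast h2⟩

/-! ### Merging and splitting cycles of permutations -/

namespace Equiv.Perm

/-- Multiplying by a cycle on a system of representatives of the nontrivial cycles merges them
all. -/
theorem sameCycle_mul_of_transversal {α : Type*} [Finite α] {σ ρ : Perm α} {s : Set α}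
    (hρ : ρ.IsCycleOn s)
    (hfix : ∀ x ∉ s, ρ x = x) (hinj : ∀ x ∈ s, ∀ y ∈ s, σ.SameCycle x y → x = y)
    (hcov : ∀ x, σ x ≠ x → ∃ e ∈ s, σ.SameCycle e x) {x y : α}
    (hx : (ρ * σ) x ≠ x) (hy : (ρ * σ) y ≠ y) : (ρ * σ).SameCycle x y := by
  have hstep : ∀ z, σ z ∉ s → (ρ * σ).SameCycle z (σ z) := by
    intro z hz
    rw [← hfix _ hz, ← mul_apply, sameCycle_apply_right]
  -- Along the `σ`-cycle of `e` the product agrees with `σ` until the return to `e`, the only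
  -- element of `s` there. At that point `ρ` diverts to the next representative.
  have horb : ∀ e ∈ s, ∀ z, σ.SameCycle e z → (ρ * σ).SameCycle e z := by
    intro e he z hz
    refine mem_of_sameCycle_of_closed (p := fun z => (ρ * σ).SameCycle e z) (.refl _ _)
      (fun w hw hp hne => hp.trans (hstep w fun hs => hne ?_)) hz
    exact hinj _ hs _ he (sameCycle_apply_left.2 hw.symm)
  have hnext : ∀ e ∈ s, (ρ * σ).SameCycle e (ρ e) := by
    intro e he
    have h1 := horb e he (σ⁻¹ e) (sameCycle_symm_apply_right.2 (.refl _ _))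
    rwa [← sameCycle_apply_right, mul_apply, coe_inv, Equiv.apply_symm_apply] at h1
  have hs : ∀ e ∈ s, ∀ e' ∈ s, (ρ * σ).SameCycle e e' := by
    intro e he e' he'
    refine (mem_of_sameCycle_of_closed (p := fun z => z ∈ s ∧ (ρ * σ).SameCycle e z)
      ⟨he, .refl _ _⟩ (fun w hw hp _ => ⟨hρ.1.mapsTo hp.1, hp.2.trans (hnext w hp.1)⟩)
      (hρ.2 he he')).2
  have hrep : ∀ z, (ρ * σ) z ≠ z → ∃ e ∈ s, (ρ * σ).SameCycle e z := by
    intro z hz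
    by_cases hσ : σ z = z
    · refine ⟨z, ?_, .refl _ _⟩
      by_contra hzs
      exact hz (by rw [mul_apply, hσ, hfix z hzs])
    · obtain ⟨e, he, hez⟩ := hcov z hσ
      exact ⟨e, he, horb e he z hez⟩
  obtain ⟨e, he, hex⟩ := hrep x hx
  obtain ⟨e', he', hey⟩ := hrep y hy
  exact hex.symm.trans ((hs e he e' he').trans hey)

/-- Multiplying by the transposition of two elements of a cycle splits this cycle. -/
theorem not_sameCycle_swap_mul {α : Type*} [Finite α] [DecidableEq α] {σ : Perm α} {x y : α}
    (hxy : x ≠ y) (h : σ.SameCycle x y) : ¬ (swap x y * σ).SameCycle x y := by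
  classical
  have hex : ∃ i : ℕ, (σ ^ i) x = y := by
    obtain ⟨i, -, hi⟩ := h.exists_pow_eq'
    exact ⟨i, hi⟩
  have hmin := fun {m} => Nat.find_min hex (m := m)
  have hspec := Nat.find_spec hex
  set i := Nat.find hex
  intro hs
  have hi0 : 0 < i := by
    rw [Nat.pos_iff_ne_zero]
    intro h0
    rw [h0] at hspec
    exact hxy (by simpa using hspec)
  -- With `i` minimal such that `σ ^ i` takes `x` to `y`, the product runs through `x`, `σ x`, …,
  -- `(σ ^ (i - 1)) x` and returns to `x` instead of reaching `y`.
  have hclosed : ∀ z, (swap x y * σ).SameCycle x z → (∃ j < i, (σ ^ j) x = z) →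
      (swap x y * σ) z ≠ x → ∃ j < i, (σ ^ j) x = (swap x y * σ) z := by
    rintro z - ⟨j, hj, rfl⟩ -
    rw [show (swap x y * σ) ((σ ^ j) x) = swap x y ((σ ^ (j + 1)) x) by rw [pow_succ']; rfl]
    rcases Nat.lt_or_ge (j + 1) i with h1 | h1
    · refine ⟨j + 1, h1, ?_⟩
      rw [swap_apply_of_ne_of_ne ?_ (hmin h1)]
      intro hx
      apply hmin (Nat.sub_lt_self (Nat.succ_pos j) h1.le)
      rw [← hspec]
      conv_rhs => rw [← Nat.sub_add_cancel h1.le, pow_add, mul_apply, hx]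
    · have : j + 1 = i := by omega
      exact ⟨0, hi0, by rw [this, hspec]; simp⟩
  obtain ⟨j, hj, hjy⟩ := mem_of_sameCycle_of_closed (p := fun z => ∃ j < i, (σ ^ j) x = z)
    ⟨0, hi0, by simp⟩ hclosed hs
  exact hmin hj hjy

/-- A system of representatives of the nontrivial cycles by elements with a given property. -/
theorem exists_transversal {α : Type*} (σ : Perm α) (p : α → Prop)
    (hp : ∀ x, σ x ≠ x → ∃ e, σ.SameCycle e x ∧ p e) :
    ∃ s : Set α, (∀ e ∈ s, p e ∧ σ e ≠ e) ∧ (∀ x ∈ s, ∀ y ∈ s, σ.SameCycle x y → x = y) ∧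
      ∀ x, σ x ≠ x → ∃ e ∈ s, σ.SameCycle e x := by
  classical
  let S := SameCycle.setoid σ
  have hq : ∀ q : Quotient S, ∃ e, σ q.out ≠ q.out → σ.SameCycle e q.out ∧ p e := by
    intro q
    by_cases h : σ q.out = q.out
    · exact ⟨q.out, fun h' => (h' h).elim⟩
    · obtain ⟨e, he⟩ := hp _ h
      exact ⟨e, fun _ => he⟩
  choose r hr using hq
  have hout : ∀ x, σ.SameCycle (Quotient.mk S x).out x := fun x => Quotient.mk_out x
  have hmv : ∀ x, σ x ≠ x → σ (Quotient.mk S x).out ≠ (Quotient.mk S x).out := fun x hx h =>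
    hx ((hout x).apply_eq_self_iff.1 h)
  refine ⟨{e | σ e ≠ e ∧ r (Quotient.mk S e) = e}, fun e he => ⟨?_, he.1⟩, ?_, fun x hx => ?_⟩
  · have := (hr _ (hmv e he.1)).2
    rwa [he.2] at this
  · intro x hx y hy hxy
    rw [← hx.2, ← hy.2, Quotient.sound (s := S) hxy]
  · have h1 := hr _ (hmv x hx)
    have h2 := h1.1.trans (hout x)
    refine ⟨_, ⟨fun h => hx (h2.apply_eq_self_iff.1 h), ?_⟩, h2⟩
    rw [Quotient.sound (s := S) h2]

end Equiv.Perm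

/-! ### Layers of the difference graph from Birkhoff's theorem -/

/-- A nonnegative matrix with constant positive row and column sums has a positive transversal. -/
theorem Matrix.exists_perm_pos {V : Type*} [Fintype V] [DecidableEq V] {N : Matrix V V ℝ} {Δ : ℝ}
    (hΔ : 0 < Δ) (h0 : ∀ v w, 0 ≤ N v w) (hrow : ∀ v, ∑ w, N v w = Δ)
    (hcol : ∀ w, ∑ v, N v w = Δ) : ∃ σ : Equiv.Perm V, ∀ v, 0 < N v (σ v) := by
  have hM : Δ⁻¹ • N ∈ doublyStochastic ℝ V := by
    rw [mem_doublyStochastic_iff_sum]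
    refine ⟨fun v w => mul_nonneg (inv_nonneg.2 hΔ.le) (h0 v w), fun v => ?_, fun w => ?_⟩
    · simp [← Finset.mul_sum, hrow, hΔ.ne']
    · simp [← Finset.mul_sum, hcol, hΔ.ne']
  obtain ⟨w, hw0, hw1, hw⟩ := exists_eq_sum_perm_of_mem_doublyStochastic hM
  obtain ⟨σ, hσ⟩ : ∃ σ, 0 < w σ := by
    by_contra! h
    have : ∑ σ, w σ ≤ 0 := Finset.sum_nonpos fun σ _ => h σ
    linarith
  refine ⟨σ, fun v => ?_⟩
  have h1 : w σ ≤ (Δ⁻¹ • N) v (σ v) := by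
    rw [← hw, Matrix.sum_apply]
    refine le_trans ?_ (Finset.single_le_sum (f := fun τ => (w τ • τ.permMatrix ℝ) v (σ v))
      (fun τ _ => ?_) (mem_univ σ))
    · simp [Equiv.Perm.permMatrix, PEquiv.toMatrix_apply]
    · simp only [Matrix.smul_apply, smul_eq_mul, Equiv.Perm.permMatrix, PEquiv.toMatrix_apply]
      refine mul_nonneg (hw0 τ) ?_
      split_ifs <;> norm_num
  have h2 : 0 < Δ⁻¹ * N v (σ v) := hσ.trans_le h1
  exact (pos_iff_pos_of_mul_pos h2).1 (inv_pos.2 hΔ)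

/-- The number of items that have to leave a cluster. -/
def outDeg (c c' : Fin n → Fin k) (i : Fin k) : ℕ := #{j | c' j ≠ c j ∧ c j = i}

/-- The number of items that have to enter a cluster. -/
def inDeg (c c' : Fin n → Fin k) (i : Fin k) : ℕ := #{j | c' j ≠ c j ∧ c' j = i}

/-- The total amount by which clusters have to shrink. -/
def totalExcess (c c' : Fin n → Fin k) : ℕ := ∑ i, (clusterSize c i - clusterSize c' i)

theorem clusterSize_add_outDeg (c c' : Fin n → Fin k) (i : Fin k) :
    clusterSize c' i + outDeg c c' i = clusterSize c i + inDeg c c' i :=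
  MovesAlong.clusterSize_add c c' i

theorem inDeg_comm (c c' : Fin n → Fin k) (i : Fin k) : inDeg c c' i = outDeg c' c i := by
  simp only [inDeg, outDeg, ne_comm]

theorem sum_clusterSize (c : Fin n → Fin k) : ∑ i, clusterSize c i = n := by
  have := Finset.card_eq_sum_card_fiberwise (f := c) (s := univ) (t := univ) (by simp)
  simpa [clusterSize] using this.symm

theorem totalExcess_comm (c c' : Fin n → Fin k) : totalExcess c c' = totalExcess c' c := by
  have h : totalExcess c c' + ∑ i, clusterSize c' i = totalExcess c' c + ∑ i, clusterSize c i := by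
    unfold totalExcess
    rw [← Finset.sum_add_distrib, ← Finset.sum_add_distrib]
    exact Finset.sum_congr rfl fun i _ => by omega
  rw [sum_clusterSize, sum_clusterSize] at h
  omega

theorem sum_arcs (c c' : Fin n → Fin k) (i : Fin k) :
    ∑ i' ∈ univ.erase i, #{j | c j = i ∧ c' j = i'} = outDeg c c' i := by
  unfold outDeg
  rw [Finset.card_eq_sum_card_fiberwise (f := c') (t := univ.erase i)]
  · refine Finset.sum_congr rfl fun i' hi' => ?_
    rw [Finset.filter_filter]
    congr 1
    ext j
    have := Finset.ne_of_mem_erase hi'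
    simp
    grind
  · intro j hj
    simp at hj ⊢
    grind

/-- The arcs of `σ` lead along arcs of the difference graph of two assignments; slack nodes join
clusters that have to grow to clusters that have to shrink. -/
structure IsLayer (c c' : Fin n → Fin k) (σ : Equiv.Perm (Fin k ⊕ Bool)) : Prop where
  arc : ∀ i i', σ (Sum.inl i) = Sum.inl i' → i ≠ i' → ∃ j, c j = i ∧ c' j = i'
  final : ∀ i u, σ (Sum.inl i) = Sum.inr u → clusterSize c i < clusterSize c' i
  start : ∀ i u, σ (Sum.inr u) = Sum.inl i → clusterSize c' i < clusterSize c i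
  slack : ∀ u u', σ (Sum.inr u) = Sum.inr u' → u = u'

/-- The weights of the arcs in a regular extension of the difference graph. -/
noncomputable def layerMatrix (c c' : Fin n → Fin k) (Δ : ℕ) (t : Bool → ℝ) :
    Matrix (Fin k ⊕ Bool) (Fin k ⊕ Bool) ℝ :=
  Matrix.of fun v w => match v, w with
    | Sum.inl i, Sum.inl i' =>
      if i' = i then (Δ : ℝ) - (max (outDeg c c' i) (inDeg c c' i) : ℕ)
      else (#{j | c j = i ∧ c' j = i'} : ℕ)
    | Sum.inl i, Sum.inr u => (clusterSize c' i - clusterSize c i : ℕ) * t u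
    | Sum.inr u, Sum.inl i => (clusterSize c i - clusterSize c' i : ℕ) * t u
    | Sum.inr u, Sum.inr u' => if u' = u then (Δ : ℝ) - totalExcess c c' * t u else 0

/-- Exchanging the assignments reverses the difference graph, so column sums reduce to row sums. -/
theorem layerMatrix_transpose (c c' : Fin n → Fin k) (Δ : ℕ) (t : Bool → ℝ) :
    (layerMatrix c c' Δ t)ᵀ = layerMatrix c' c Δ t := by
  ext v w
  rcases v with i | u <;> rcases w with i' | u' <;> simp only [layerMatrix, Matrix.transpose_apply,
    Matrix.of_apply]
  · by_cases h : i = i'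
    · subst h
      simp [inDeg_comm, max_comm]
    · simp only [if_neg h, if_neg (Ne.symm h), and_comm]
  · by_cases h : u = u'
    · subst h
      simp [totalExcess_comm]
    · simp only [if_neg h, if_neg (Ne.symm h)]

/-- The out-degree of a cluster plus the amount by which it has to grow is the maximum of its two
degrees, and its loop supplies the rest of `Δ`. The number `t u` is the share of the excess that
passes through slack node `u`; without excess the shares do not matter. -/
theorem sum_layerMatrix {c c' : Fin n → Fin k} {Δ : ℕ} {t : Bool → ℝ}
    (ht : totalExcess c c' ≠ 0 → t false + t true = 1) (v : Fin k ⊕ Bool) :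
    ∑ w, layerMatrix c c' Δ t v w = Δ := by
  rcases v with i | u
  · simp only [layerMatrix, Matrix.of_apply, Fintype.sum_sum_type, Fintype.sum_bool]
    rw [← Finset.add_sum_erase _ _ (mem_univ i), if_pos rfl, Finset.sum_congr rfl fun i' hi' =>
      if_neg (Finset.ne_of_mem_erase hi'), ← Nat.cast_sum, sum_arcs]
    have h1 := clusterSize_add_outDeg c c' i
    have h2 : max (outDeg c c' i) (inDeg c c' i) =
        outDeg c c' i + (clusterSize c' i - clusterSize c i) := by omega
    have h3 : ((clusterSize c' i - clusterSize c i : ℕ) : ℝ) * (t false + t true) =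
        (clusterSize c' i - clusterSize c i : ℕ) := by
      by_cases hP : totalExcess c c' = 0
      · rw [totalExcess_comm] at hP
        have := (Finset.sum_eq_zero_iff.1 hP) i (mem_univ i)
        simp [this]
      · rw [ht hP, mul_one]
    rw [h2]
    push_cast at h3 ⊢
    linarith
  · simp only [layerMatrix, Matrix.of_apply, Fintype.sum_sum_type, ← Finset.sum_mul,
      ← Nat.cast_sum]
    rw [Finset.sum_ite_eq' univ u]
    simp [totalExcess]

/-- The swap only exchanges the slack nodes in which paths end. It serves to separate two paths that
lie on a common cycle. -/
theorem IsLayer.swap_mul {c c' : Fin n → Fin k} {σ : Equiv.Perm (Fin k ⊕ Bool)}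
    (h : IsLayer c c' σ) (hs : ∀ u, σ (Sum.inr u) ≠ Sum.inr u) :
    IsLayer c c' (Equiv.swap (Sum.inr false) (Sum.inr true) * σ) := by
  set τ : Equiv.Perm (Fin k ⊕ Bool) := Equiv.swap (Sum.inr false) (Sum.inr true) with hτ
  have key : ∀ v i, (τ * σ) v = Sum.inl i → σ v = Sum.inl i := by
    intro v i hv
    rw [Equiv.Perm.mul_apply] at hv
    rcases hw : σ v with i' | u
    · rw [hw, hτ, Equiv.swap_apply_of_ne_of_ne (by simp) (by simp)] at hv
      exact hv
    · cases u <;> simp [hw, hτ] at hv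
  have key' : ∀ v u, (τ * σ) v = Sum.inr u → ∃ u', σ v = Sum.inr u' := by
    intro v u hv
    rw [Equiv.Perm.mul_apply] at hv
    rcases hw : σ v with i' | u
    · rw [hw, hτ, Equiv.swap_apply_of_ne_of_ne (by simp) (by simp)] at hv
      simp at hv
    · exact ⟨u, rfl⟩
  refine ⟨fun i i' hi => h.arc i i' (key _ _ hi), fun i u hi => ?_,
    fun i u hi => h.start i u (key _ _ hi), fun u u' hu => ?_⟩
  · obtain ⟨u', hu'⟩ := key' _ _ hi
    exact h.final i u' hu'
  · obtain ⟨u₁, hu₁⟩ := key' _ _ hu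
    have := h.slack u u₁ hu₁
    subst this
    exact (hs u hu₁).elim

/-- There is a layer that passes through all clusters of maximal degree. -/
theorem exists_isLayer {c c' : Fin n → Fin k} {Δ : ℕ} (hΔ : 0 < Δ)
    (hout : ∀ i, outDeg c c' i ≤ Δ) (hin : ∀ i, inDeg c c' i ≤ Δ)
    (hP : totalExcess c c' ≤ 2 * Δ) :
    ∃ σ, IsLayer c c' σ ∧
      (∀ i, σ (Sum.inl i) = Sum.inl i → outDeg c c' i < Δ ∧ inDeg c c' i < Δ) ∧
      (2 * Δ ≤ totalExcess c c' + 1 → σ (Sum.inr false) ≠ Sum.inr false) ∧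
      (2 * Δ ≤ totalExcess c c' → σ (Sum.inr true) ≠ Sum.inr true) ∧
      ¬ σ.SameCycle (Sum.inr false) (Sum.inr true) := by
  set P := totalExcess c c' with hPdef
  -- Slack node `false` takes `min P Δ` of the excess and `true` the remainder, both at most `Δ`. A
  -- slack node with share exactly `Δ` has no loop, so `σ` must move it: `false` as soon as `P ≥ Δ`,
  -- and `true` when `P = 2 * Δ`.
  let t : Bool → ℝ := fun u => (if u then P - min P Δ else min P Δ : ℕ) / P
  have htP : ∀ u, P * t u = (if u then P - min P Δ else min P Δ : ℕ) := by
    intro u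
    by_cases h0 : P = 0
    · simp only [h0, Nat.cast_zero, zero_mul, Nat.zero_min, Nat.sub_self, ite_self]
    · have : (P : ℝ) ≠ 0 := by exact_mod_cast h0
      simp only [t]
      field_simp
  have ht0 : ∀ u, 0 ≤ t u := fun u => div_nonneg (Nat.cast_nonneg _) (Nat.cast_nonneg _)
  have ht : P ≠ 0 → t false + t true = 1 := by
    intro h0
    have h1 : (P : ℝ) ≠ 0 := by exact_mod_cast h0
    refine mul_left_cancel₀ h1 ?_
    rw [mul_add, htP, htP, ← Nat.cast_add, mul_one]
    congr 1
    simp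
  have hnonneg : ∀ v w, 0 ≤ layerMatrix c c' Δ t v w := by
    intro v w
    rcases v with i | u <;> rcases w with i' | u' <;> simp only [layerMatrix, Matrix.of_apply]
    · split_ifs
      · rw [sub_nonneg, Nat.cast_le]
        exact max_le (hout i) (hin i)
      · exact Nat.cast_nonneg _
    · exact mul_nonneg (Nat.cast_nonneg _) (ht0 _)
    · exact mul_nonneg (Nat.cast_nonneg _) (ht0 _)
    · split_ifs
      · rw [sub_nonneg, htP, Nat.cast_le]
        cases u <;> simp; omega
      · rfl
  have hcol : ∀ w, ∑ v, layerMatrix c c' Δ t v w = Δ := by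
    intro w
    have := sum_layerMatrix (c := c') (c' := c) (Δ := Δ) (t := t)
      (fun h => ht (by rwa [hPdef, totalExcess_comm])) w
    rw [← layerMatrix_transpose] at this
    simpa using this
  obtain ⟨σ, hσ⟩ := Matrix.exists_perm_pos (by exact_mod_cast hΔ) hnonneg
    (sum_layerMatrix ht) hcol
  have hlayer : IsLayer c c' σ := by
    refine ⟨fun i i' hi hne => ?_, fun i u hi => ?_, fun i u hi => ?_, fun u u' hu => ?_⟩
    · have := hσ (Sum.inl i)
      rw [hi] at this
      simp only [layerMatrix, Matrix.of_apply, if_neg hne.symm, Nat.cast_pos,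
        Finset.card_pos] at this
      obtain ⟨j, hj⟩ := this
      exact ⟨j, by simpa using hj⟩
    · have := hσ (Sum.inl i)
      rw [hi] at this
      simp only [layerMatrix, Matrix.of_apply] at this
      have := (pos_iff_pos_of_mul_pos this).2 (lt_of_le_of_ne (ht0 u) fun h => by simp [← h] at this)
      rw [Nat.cast_pos] at this
      omega
    · have := hσ (Sum.inr u)
      rw [hi] at this
      simp only [layerMatrix, Matrix.of_apply] at this
      have := (pos_iff_pos_of_mul_pos this).2 (lt_of_le_of_ne (ht0 u) fun h => by simp [← h] at this)
      rw [Nat.cast_pos] at this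
      omega
    · have := hσ (Sum.inr u)
      rw [hu] at this
      by_contra hne
      simp [layerMatrix, Ne.symm hne] at this
  have hfix : ∀ i, σ (Sum.inl i) = Sum.inl i → outDeg c c' i < Δ ∧ inDeg c c' i < Δ := by
    intro i hi
    have := hσ (Sum.inl i)
    rw [hi] at this
    simp only [layerMatrix, Matrix.of_apply, if_true, sub_pos, Nat.cast_lt] at this
    omega
  have hslack : ∀ u, σ (Sum.inr u) = Sum.inr u → (if u then P - min P Δ else min P Δ) < Δ := by
    intro u hu
    have := hσ (Sum.inr u)
    rw [hu] at this
    simpa only [layerMatrix, Matrix.of_apply, if_true, sub_pos, ← hPdef, htP, Nat.cast_lt]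
      using this
  -- If a cycle contains both slack nodes, the transposition of these splits it.
  by_cases hsc : σ.SameCycle (Sum.inr false) (Sum.inr true)
  · have hs : ∀ u, σ (Sum.inr u) ≠ Sum.inr u := by
      intro u hu
      cases u
      · simpa using hsc.eq_of_left hu
      · simpa using hsc.eq_of_right hu
    have hl := hlayer.swap_mul hs
    have hns : ∀ u, (Equiv.swap (Sum.inr false) (Sum.inr true) * σ :
        Equiv.Perm (Fin k ⊕ Bool)) (Sum.inr u) ≠ Sum.inr u := by
      intro u hu
      rw [Equiv.Perm.mul_apply, Equiv.swap_apply_eq_iff] at hu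
      have h1 : ∃ u', σ (Sum.inr u) = Sum.inr u' := by
        cases u
        · exact ⟨true, by simpa using hu⟩
        · exact ⟨false, by simpa using hu⟩
      obtain ⟨u', hu'⟩ := h1
      have := hlayer.slack u u' hu'
      subst this
      exact hs u hu'
    refine ⟨_, hl, fun i hi => hfix i ?_, fun _ => hns _, fun _ => hns _,
      Equiv.Perm.not_sameCycle_swap_mul (by simp) hsc⟩
    rw [Equiv.Perm.mul_apply, Equiv.swap_apply_eq_iff,
      Equiv.swap_apply_of_ne_of_ne (by simp) (by simp)] at hi
    exact hi
  · refine ⟨σ, hlayer, hfix, fun h h' => ?_, fun h h' => ?_, hsc⟩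
    · have := hslack _ h'
      simp at this
      omega
    · have := hslack _ h'
      simp at this
      omega

/-! ### Two circuit steps for a layer -/

/-- There is a circuit walk with at most `N` steps between the points of two assignments. -/
def WithinSteps (κp κm : Fin k → ℕ) (c c' : Fin n → Fin k) (N : ℕ) : Prop :=
  ∃ M ≤ N, (boundedSizePartitionSystem n k κp κm).HasCircuitWalk (assignmentPoint c)
    (assignmentPoint c') M

/-- One assignment arises from the other by at most one circuit step. -/
def StepOrEq (κp κm : Fin k → ℕ) (c c' : Fin n → Fin k) : Prop :=
  c' = c ∨ (boundedSizePartitionSystem n k κp κm).IsCircuitStep (assignmentPoint c)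
    (assignmentPoint c')

theorem WithinSteps.refl (κp κm : Fin k → ℕ) (c : Fin n → Fin k) (N : ℕ) :
    WithinSteps κp κm c c N :=
  ⟨0, Nat.zero_le _, fun _ => assignmentPoint c, rfl, rfl, fun t => t.elim0⟩

theorem StepOrEq.withinSteps {κp κm : Fin k → ℕ} {c c₁ c' : Fin n → Fin k} {N : ℕ}
    (h : StepOrEq κp κm c c₁) (h' : WithinSteps κp κm c₁ c' N) :
    WithinSteps κp κm c c' (N + 1) := by
  obtain ⟨M, hM, w, hw0, hw1, hw⟩ := h'
  rcases h with rfl | h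
  · exact ⟨M, hM.trans (Nat.le_succ N), w, hw0, hw1, hw⟩
  · refine ⟨M + 1, Nat.succ_le_succ hM, Fin.cons (assignmentPoint c) w, rfl, ?_, fun t => ?_⟩
    · rw [← Fin.succ_last, Fin.cons_succ, hw1]
    · refine Fin.cases ?_ (fun t => ?_) t
      · simpa [hw0] using h
      · rw [← Fin.succ_castSucc, Fin.cons_succ, Fin.cons_succ]
        exact hw t

theorem MovesAlong.stepOrEq {π : Equiv.Perm (Fin k ⊕ Bool)} {L : Finset (Fin n)}
    {c c₁ : Fin n → Fin k} (h : MovesAlong π L c c₁) {κp κm : Fin k → ℕ}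
    (hcyc : ∀ x y, π x ≠ x → π y ≠ y → π.SameCycle x y)
    (hslack : ∃ u, π (Sum.inr u) = Sum.inr u) (hc : IsAdmissible κp κm c)
    (hc₁ : IsAdmissible κp κm c₁) : StepOrEq κp κm c c₁ := by
  by_cases hne : c₁ = c
  · exact Or.inl hne
  · exact Or.inr (h.isCircuitStep hne hcyc hslack hc hc₁)

/-- Moves along a product of two permutations can be done in two circuit steps if both factors
become cycles when they are multiplied by a suitable cycle on a common system of
representatives of their cycles. -/
theorem MovesAlong.exists_two_steps {σ₁ D : Equiv.Perm (Fin k ⊕ Bool)} {L : Finset (Fin n)}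
    {c c₂ : Fin n → Fin k} (h : MovesAlong (D * σ₁) L c c₂) {s : Set (Fin k ⊕ Bool)}
    (hs : ∀ e ∈ s, ∃ i i', e = Sum.inl i ∧ σ₁ (Sum.inl i') = Sum.inl i)
    (hmv : ∀ e ∈ s, σ₁ e ≠ e)
    (hinj : ∀ x ∈ s, ∀ y ∈ s, σ₁.SameCycle x y → x = y)
    (hcov : ∀ x, σ₁ x ≠ x → ∃ e ∈ s, σ₁.SameCycle e x)
    (hDinj : ∀ x ∈ s, ∀ y ∈ s, D.SameCycle x y → x = y)
    (hDcov : ∀ x, D x ≠ x → ∃ e ∈ s, D.SameCycle e x)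
    (hon : ∀ j ∈ L, ∃ i, σ₁ (Sum.inl (c j)) = Sum.inl i)
    (hcover : ∀ v w, σ₁ (Sum.inl v) = Sum.inl w → v ≠ w →
      ∃ w', (D * σ₁) (Sum.inl v) = Sum.inl w' ∧ v ≠ w')
    (hslack : ∃ u, σ₁ (Sum.inr u) = Sum.inr u) (hDslack : ∃ u, D (Sum.inr u) = Sum.inr u)
    (hstart : ∀ u i, σ₁ (Sum.inr u) = Sum.inl i → D (Sum.inl i) = Sum.inl i)
    {κp κm : Fin k → ℕ} (hc : IsAdmissible κp κm c) (hc₂ : IsAdmissible κp κm c₂)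
    (hup : ∀ i u, σ₁ (Sum.inl i) = Sum.inr u → clusterSize c i < κp i)
    (hlow : ∀ i u, σ₁ (Sum.inr u) = Sum.inl i → κm i < clusterSize c i) :
    ∃ c₁, StepOrEq κp κm c c₁ ∧ StepOrEq κp κm c₁ c₂ := by
  classical
  -- The steps follow `ρ * σ₁` and then `D * ρ⁻¹`. Each element of `s` is a cluster entered from a
  -- cluster, so `ρ` diverts only items and leaves the slack nodes and the starts of paths alone.
  obtain ⟨ρ, hρ, hρs⟩ := Finset.exists_cycleOn (Set.toFinite s).toFinset
  rw [Set.Finite.coe_toFinset] at hρ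
  have hρfix : ∀ x ∉ s, ρ x = x := by
    intro x hx
    by_contra hne
    exact hx (by simpa using hρs (Equiv.Perm.mem_support.2 hne))
  have hρinl : ∀ i, ∃ i', ρ (Sum.inl i) = Sum.inl i' := by
    intro i
    by_cases hi : (Sum.inl i : Fin k ⊕ Bool) ∈ s
    · obtain ⟨i', -, hi', -⟩ := hs _ (hρ.1.mapsTo hi)
      exact ⟨i', hi'⟩
    · exact ⟨i, hρfix _ hi⟩
  have hρinr : ∀ u, ρ (Sum.inr u) = Sum.inr u := by
    intro u
    refine hρfix _ fun hu => ?_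
    obtain ⟨i, -, hi, -⟩ := hs _ hu
    simp at hi
  have hρstart : ∀ u i, σ₁ (Sum.inr u) = Sum.inl i → ρ (Sum.inl i) = Sum.inl i := by
    intro u i hi
    refine hρfix _ fun his => ?_
    obtain ⟨i₁, i₂, h1, h2⟩ := hs _ his
    rw [← h1, ← hi] at h2
    simpa using σ₁.injective h2
  have hfix : ∀ x, σ₁ x = x → (ρ * σ₁) x = x := by
    intro x hx
    rw [Equiv.Perm.mul_apply, hx, hρfix x fun hxs => hmv x hxs hx]
  have hinr : ∀ v u, (ρ * σ₁) v = Sum.inr u → σ₁ v = Sum.inr u := by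
    intro v u hv
    rw [Equiv.Perm.mul_apply, ← hρinr u] at hv
    exact ρ.injective hv
  have hdef : ∀ j, ∃ i, (j ∈ L → (ρ * σ₁) (Sum.inl (c j)) = Sum.inl i) ∧ (j ∉ L → i = c j) := by
    intro j
    by_cases hj : j ∈ L
    · obtain ⟨i, hi⟩ := hon j hj
      obtain ⟨i', hi'⟩ := hρinl i
      exact ⟨i', fun _ => by rw [Equiv.Perm.mul_apply, hi, hi'], fun h => (h hj).elim⟩
    · exact ⟨c j, fun h => (hj h).elim, fun _ => rfl⟩
  choose c₁ hc₁on hc₁off using hdef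
  have hm₁ : MovesAlong (ρ * σ₁) L c c₁ := by
    refine ⟨hc₁off, hc₁on, h.inj, fun v w hvw hne => ?_⟩
    rcases hv : σ₁ (Sum.inl v) with w' | u
    · by_cases hvw' : v = w'
      · subst hvw'
        rw [hfix _ hv] at hvw
        exact (hne (Sum.inl_injective hvw)).elim
      · obtain ⟨w'', hw'', hne'⟩ := hcover v w' hv hvw'
        exact h.cover v w'' hw'' hne'
    · rw [Equiv.Perm.mul_apply, hv, hρinr] at hvw
      simp at hvw
  have hprod : D * ρ⁻¹ * (ρ * σ₁) = D * σ₁ := by group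
  have hprod' : ∀ x, (D * ρ⁻¹) ((ρ * σ₁) x) = (D * σ₁) x := fun x => by
    rw [← hprod]; rfl
  have hm₂ : MovesAlong (D * ρ⁻¹) L c₁ c₂ := by
    refine ⟨fun j hj => by rw [h.off j hj, hc₁off j hj], fun j hj => ?_, fun j hj j' hj' he => ?_,
      fun v w hvw hne => ?_⟩
    · rw [← hc₁on j hj, hprod', h.on j hj]
    · exact h.inj j hj j' hj' (Sum.inl_injective ((ρ * σ₁).injective (by
        rw [hc₁on j hj, hc₁on j' hj', he])))
    -- The item to be moved out of `v` is the one that the first step brought there, from the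
    -- preimage of `v` under `ρ * σ₁`. All other origins are contradictory.
    · obtain ⟨x, hx⟩ := (ρ * σ₁).surjective (Sum.inl v)
      have hxw : (D * σ₁) x = Sum.inl w := by rw [← hprod', hx, hvw]
      rcases x with v' | u
      · by_cases hv' : v' = w
        · subst hv'
          exfalso
          rcases hσ : σ₁ (Sum.inl v') with w' | u
          · by_cases hvw' : v' = w'
            · subst hvw'
              rw [hfix _ hσ] at hx
              exact hne (Sum.inl_injective hx).symm
            · obtain ⟨w'', hw'', hne'⟩ := hcover v' w' hσ hvw'
              rw [hxw] at hw''
              exact hne' (Sum.inl_injective hw'')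
          · rw [Equiv.Perm.mul_apply, hσ, hρinr] at hx
            simp at hx
        · obtain ⟨j, hj, rfl⟩ := h.cover v' w hxw hv'
          refine ⟨j, hj, Sum.inl_injective (β := Bool) ?_⟩
          rw [← hc₁on j hj, hx]
      · exfalso
        rcases hσ : σ₁ (Sum.inr u) with i | u'
        · rw [Equiv.Perm.mul_apply, hσ] at hx hxw
          rw [hρstart u i hσ] at hx
          rw [hstart u i hσ] at hxw
          exact hne (Sum.inl_injective (hx.symm.trans hxw))
        · rw [Equiv.Perm.mul_apply, hσ, hρinr] at hx
          simp at hx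
  have hc₁ : IsAdmissible κp κm c₁ := by
    refine hm₁.isAdmissible hc (fun i u hi => hup i u (hinr _ _ hi)) fun i u hi => ?_
    rcases hσ : σ₁ (Sum.inr u) with i' | u'
    · rw [Equiv.Perm.mul_apply, hσ, hρstart u i' hσ] at hi
      rw [← Sum.inl_injective hi]
      exact hlow i' u hσ
    · rw [Equiv.Perm.mul_apply, hσ, hρinr] at hi
      simp at hi
  refine ⟨c₁, hm₁.stepOrEq (fun x y => Equiv.Perm.sameCycle_mul_of_transversal hρ hρfix hinj hcov)
    ?_ hc hc₁, hm₂.stepOrEq (fun x y hx hy => ?_) ?_ hc₁ hc₂⟩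
  · obtain ⟨u, hu⟩ := hslack
    exact ⟨u, hfix _ hu⟩
  -- Passing to the inverse puts `ρ` on the left, as the merging lemma requires.
  · have hinv : D * ρ⁻¹ = (ρ * D⁻¹)⁻¹ := by group
    rw [hinv, Equiv.Perm.sameCycle_inv]
    have hmvd : ∀ z, (D * ρ⁻¹) z ≠ z → (ρ * D⁻¹) z ≠ z := by
      intro z hz hz'
      rw [hinv] at hz
      exact hz (Equiv.Perm.inv_eq_iff_eq.2 hz'.symm)
    refine Equiv.Perm.sameCycle_mul_of_transversal hρ hρfix
      (fun x hx y hy hxy => hDinj x hx y hy (Equiv.Perm.sameCycle_inv.1 hxy)) (fun z hz => ?_)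
      (hmvd x hx) (hmvd y hy)
    obtain ⟨e, he, hez⟩ := hDcov z fun h => hz (Equiv.Perm.inv_eq_iff_eq.2 h.symm)
    exact ⟨e, he, Equiv.Perm.sameCycle_inv.2 hez⟩
  · obtain ⟨u, hu⟩ := hDslack
    refine ⟨u, ?_⟩
    rw [Equiv.Perm.mul_apply, Equiv.Perm.inv_eq_iff_eq.2 (hρinr u).symm, hu]

/-- The items that a permutation moves can be chosen among those that belong to its arcs. -/
theorem IsLayer.exists_movesAlong {c c' : Fin n → Fin k} {σ : Equiv.Perm (Fin k ⊕ Bool)}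
    (h : IsLayer c c' σ) :
    ∃ L c₂, MovesAlong σ L c c₂ ∧ ∀ j, c₂ j = c j ∨ c₂ j = c' j := by
  classical
  -- Several items may lie on one arc; `f` selects one for each arc of `σ` between different
  -- clusters.
  have hf : ∀ i, ∃ o : Option (Fin n), ∀ i', σ (Sum.inl i) = Sum.inl i' → i ≠ i' →
      ∃ j, o = some j ∧ c j = i ∧ c' j = i' := by
    intro i
    by_cases hi : ∃ i', σ (Sum.inl i) = Sum.inl i' ∧ i ≠ i'
    · obtain ⟨i', hi', hne⟩ := hi
      obtain ⟨j, hj, hj'⟩ := h.arc i i' hi' hne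
      refine ⟨some j, fun i'' hi'' _ => ⟨j, rfl, hj, ?_⟩⟩
      rw [hj', Sum.inl_injective (hi'.symm.trans hi'')]
    · exact ⟨none, fun i' hi' hne => (hi ⟨i', hi', hne⟩).elim⟩
  choose f hf using hf
  refine ⟨Finset.univ.filter fun j => f (c j) = some j ∧ σ (Sum.inl (c j)) = Sum.inl (c' j),
    fun j => if f (c j) = some j ∧ σ (Sum.inl (c j)) = Sum.inl (c' j) then c' j else c j,
    ⟨fun j hj => ?_, fun j hj => ?_, fun j hj j' hj' he => ?_, fun v w hvw hne => ?_⟩,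
    fun j => ?_⟩
  · simp only [Finset.mem_filter, Finset.mem_univ, true_and] at hj
    rw [if_neg hj]
  · simp only [Finset.mem_filter, Finset.mem_univ, true_and] at hj
    rw [if_pos hj, hj.2]
  · simp only [Finset.mem_filter, Finset.mem_univ, true_and] at hj hj'
    exact Option.some_injective _ (by rw [← hj.1, ← hj'.1, he])
  · obtain ⟨j, hj, rfl, rfl⟩ := hf v w hvw hne
    exact ⟨j, by simp [hj, hvw], rfl⟩
  · by_cases hj : f (c j) = some j ∧ σ (Sum.inl (c j)) = Sum.inl (c' j)
    · exact Or.inr (if_pos hj)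
    · exact Or.inl (if_neg hj)

namespace IsLayer

variable {c c' : Fin n → Fin k} {σ : Equiv.Perm (Fin k ⊕ Bool)}

theorem not_start_final (h : IsLayer c c' σ) {i : Fin k} {u u' : Bool}
    (hs : σ (Sum.inr u) = Sum.inl i) (hf : σ (Sum.inl i) = Sum.inr u') : False :=
  absurd (h.start i u hs) (h.final i u' hf).not_gt

theorem exists_pred_slack (h : IsLayer c c' σ) {u : Bool} (hu : σ (Sum.inr u) ≠ Sum.inr u) :
    ∃ i, σ (Sum.inl i) = Sum.inr u := by
  obtain ⟨x, hx⟩ := σ.surjective (Sum.inr u)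
  rcases x with i | u'
  · exact ⟨i, hx⟩
  · have := h.slack u' u hx
    subst this
    exact (hu hx).elim

theorem isAdmissible (h : IsLayer c c' σ) {κp κm : Fin k → ℕ} (hc : IsAdmissible κp κm c)
    (hc' : IsAdmissible κp κm c') {L : Finset (Fin n)} {c₂ : Fin n → Fin k}
    (hm : MovesAlong σ L c c₂) : IsAdmissible κp κm c₂ :=
  hm.isAdmissible hc (fun i u hi => (h.final i u hi).trans_le (hc' i).2)
    fun i u hi => (hc' i).1.trans_lt (h.start i u hi)

/-- A layer that uses at most one slack node takes at most two circuit steps. -/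
theorem exists_two_steps_of_slack (h : IsLayer c c' σ) {κp κm : Fin k → ℕ}
    (hc : IsAdmissible κp κm c) (hc' : IsAdmissible κp κm c') {L : Finset (Fin n)}
    {c₂ : Fin n → Fin k} (hm : MovesAlong σ L c c₂) (hslack : ∃ u, σ (Sum.inr u) = Sum.inr u) :
    ∃ c₁, StepOrEq κp κm c c₁ ∧ StepOrEq κp κm c₁ c₂ := by
  obtain ⟨s, hs, hinj, hcov⟩ := Equiv.Perm.exists_transversal σ
    (fun e => ∃ i i', e = Sum.inl i ∧ σ (Sum.inl i') = Sum.inl i) (by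
    intro x hx
    -- On a cycle with a slack node the end of the path is a suitable representative: it has to
    -- grow, so no path starts there and its predecessor is a cluster. On a cycle without slack
    -- nodes any element will do.
    by_cases hex : ∃ u, σ (Sum.inr u) ≠ Sum.inr u ∧ σ.SameCycle (Sum.inr u) x
    · obtain ⟨u, hu, hux⟩ := hex
      obtain ⟨i, hi⟩ := h.exists_pred_slack hu
      refine ⟨Sum.inl i, ?_, i, ?_⟩
      · rwa [← Equiv.Perm.sameCycle_apply_left, hi]
      · obtain ⟨y, hy⟩ := σ.surjective (Sum.inl i)
        rcases y with i' | u'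
        · exact ⟨i', rfl, hy⟩
        · exact (h.not_start_final hy hi).elim
    · push Not at hex
      obtain ⟨y, hy⟩ := σ.surjective x
      have hyx : σ.SameCycle y x := by
        rw [← hy, Equiv.Perm.sameCycle_apply_right]
      have hmv : ∀ u, σ.SameCycle (Sum.inr u) x → False := fun u hu =>
        hex u (fun hf => hx (hu.apply_eq_self_iff.1 hf)) hu
      rcases x with i | u
      · rcases y with i' | u
        · exact ⟨_, .refl _ _, i, i', rfl, hy⟩
        · exact (hmv u hyx).elim
      · exact (hmv u (.refl _ _)).elim)
  refine MovesAlong.exists_two_steps (D := 1) (σ₁ := σ) (by rwa [one_mul])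
    (fun e he => (hs e he).1) (fun e he => (hs e he).2) hinj hcov
    (fun x _ y _ hxy => Equiv.Perm.sameCycle_one.1 hxy) (fun x hx => (hx rfl).elim)
    (fun j hj => ⟨_, hm.on j hj⟩) (fun v w hvw hne => ⟨w, by rwa [one_mul], hne⟩) hslack
    ⟨true, rfl⟩ (fun _ _ _ => rfl) hc (h.isAdmissible hc hc' hm)
    (fun i u hi => (h.final i u hi).trans_le (hc' i).2)
    fun i u hi => (hc' i).1.trans_lt (h.start i u hi)

/-- A layer that uses both slack nodes, in different cycles, takes at most two circuit steps. -/
theorem exists_two_steps_of_not_sameCycle (h : IsLayer c c' σ) {κp κm : Fin k → ℕ}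
    (hc : IsAdmissible κp κm c) (hc' : IsAdmissible κp κm c') {L : Finset (Fin n)}
    {c₂ : Fin n → Fin k} (hm : MovesAlong σ L c c₂)
    (hmv : ∀ u, σ (Sum.inr u) ≠ Sum.inr u)
    (hsep : ¬ σ.SameCycle (Sum.inr false) (Sum.inr true)) :
    ∃ c₁, StepOrEq κp κm c c₁ ∧ StepOrEq κp κm c₁ c₂ := by
  classical
  set z₁ : Fin k ⊕ Bool := Sum.inr false with hz₁
  set z₂ : Fin k ⊕ Bool := Sum.inr true with hz₂
  obtain ⟨b₁, hb₁⟩ := h.exists_pred_slack (hmv false)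
  obtain ⟨b₂, hb₂⟩ := h.exists_pred_slack (hmv true)
  have hne : b₁ ≠ b₂ := by
    rintro rfl
    simp [hb₁] at hb₂
  have hz₁b : σ.SameCycle z₁ (Sum.inl b₁) := by
    rw [← Equiv.Perm.sameCycle_apply_right, hb₁]
  have hz₂b : σ.SameCycle z₂ (Sum.inl b₂) := by
    rw [← Equiv.Perm.sameCycle_apply_right, hb₂]
  have hz₁n : ¬ σ.SameCycle z₂ z₁ := fun h => hsep h.symm
  have hb₁n : ¬ σ.SameCycle z₂ (Sum.inl b₁) := fun h => hz₁n (h.trans hz₁b.symm)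
  -- Let `b₁` and `b₂` be the ends of the paths. `σ₁` consists of the cycles and the first path,
  -- redirected to end in `b₂`. `D` is the second path prolonged from `b₂` to `b₁`, which carries
  -- the surplus item on. Their product agrees with `σ` off `b₁` and `b₂`, which no item of the
  -- layer leaves.
  let τ : Equiv.Perm (Fin k ⊕ Bool) := Equiv.swap (Sum.inl b₁) (Sum.inl b₂)
  let E : Equiv.Perm (Fin k ⊕ Bool) := σ.cycleOf z₂
  let σ' : Equiv.Perm (Fin k ⊕ Bool) := E⁻¹ * σ
  let σ₁ : Equiv.Perm (Fin k ⊕ Bool) := τ * σ' * τ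
  let D : Equiv.Perm (Fin k ⊕ Bool) := E * τ
  have hτ₁ : τ (Sum.inl b₁) = Sum.inl b₂ := Equiv.swap_apply_left _ _
  have hτ₂ : τ (Sum.inl b₂) = Sum.inl b₁ := Equiv.swap_apply_right _ _
  have hτ : ∀ x, x ≠ Sum.inl b₁ → x ≠ Sum.inl b₂ → τ x = x := fun x h1 h2 =>
    Equiv.swap_apply_of_ne_of_ne h1 h2
  have hτr : ∀ u, τ (Sum.inr u) = Sum.inr u := fun u => hτ _ (by simp) (by simp)
  have hτl : ∀ i, ∃ i', τ (Sum.inl i) = Sum.inl i' := by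
    intro i
    by_cases h1 : i = b₁
    · exact ⟨b₂, by rw [h1, hτ₁]⟩
    · by_cases h2 : i = b₂
      · exact ⟨b₁, by rw [h2, hτ₂]⟩
      · exact ⟨i, hτ _ (by simpa using h1) (by simpa using h2)⟩
  have hE : ∀ x, σ.SameCycle z₂ x → E x = σ x := fun x hx => hx.cycleOf_apply
  have hEn : ∀ x, ¬ σ.SameCycle z₂ x → E x = x := fun x hx =>
    Equiv.Perm.cycleOf_apply_of_not_sameCycle hx
  have hσ' : ∀ x, σ.SameCycle z₂ x → σ' x = x := fun x hx => by
    rw [Equiv.Perm.mul_apply, Equiv.Perm.inv_eq_iff_eq, hE x hx]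
  have hσn : ∀ x, ¬ σ.SameCycle z₂ x → σ' x = σ x := fun x hx => by
    rw [Equiv.Perm.mul_apply, Equiv.Perm.inv_eq_iff_eq, hEn]
    rwa [Equiv.Perm.sameCycle_apply_right]
  have hσor : ∀ x, σ' x = x ∨ σ' x = σ x := fun x => by
    by_cases hx : σ.SameCycle z₂ x
    · exact Or.inl (hσ' x hx)
    · exact Or.inr (hσn x hx)
  have hσ₁ : ∀ x, x ≠ Sum.inl b₁ → x ≠ Sum.inl b₂ → σ₁ x = τ (σ' x) := fun x h1 h2 => by
    simp only [σ₁, Equiv.Perm.mul_apply, hτ x h1 h2]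
  have hσ₁b₁ : σ₁ (Sum.inl b₁) = Sum.inl b₁ := by
    simp only [σ₁, Equiv.Perm.mul_apply, hτ₁, hσ' _ hz₂b, hτ₂]
  have hσ₁b₂ : σ₁ (Sum.inl b₂) = z₁ := by
    simp only [σ₁, Equiv.Perm.mul_apply, hτ₂, hσn _ hb₁n, hb₁, hτr, hz₁]
  have hσ₁z₂ : σ₁ z₂ = z₂ := by
    rw [hσ₁ _ (by simp [hz₂]) (by simp [hz₂]), hσ' _ (.refl _ _), hτr]
  have hprod : D * σ₁ = σ * τ := by
    have : D * σ₁ = E * (τ * τ) * E⁻¹ * σ * τ := by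
      simp only [D, σ₁, σ', mul_assoc]
    rw [this, Equiv.swap_mul_self]
    group
  have hD : ∀ x, x ≠ Sum.inl b₁ → ¬ σ.SameCycle z₂ x → D x = x := by
    intro x h1 h2
    have h3 : x ≠ Sum.inl b₂ := by rintro rfl; exact h2 hz₂b
    rw [Equiv.Perm.mul_apply, hτ x h1 h3, hEn x h2]
  -- the cluster where the first path begins
  obtain ⟨a, ha⟩ : ∃ a, σ z₁ = Sum.inl a := by
    rcases hx : σ z₁ with a | u
    · exact ⟨a, rfl⟩
    · have := h.slack false u hx
      subst this
      exact (hmv _ hx).elim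
  have hab₁ : a ≠ b₁ := by rintro rfl; exact h.not_start_final ha hb₁
  have hab₂ : a ≠ b₂ := by rintro rfl; exact h.not_start_final ha hb₂
  have hσ₁z₁ : σ₁ z₁ = Sum.inl a := by
    rw [hσ₁ _ (by simp [hz₁]) (by simp [hz₁]), hσn _ hz₁n, ha,
      hτ _ (by simpa using hab₁) (by simpa using hab₂)]
  have hpred : ∃ y, σ₁ (Sum.inl y) = Sum.inl b₂ := by
    obtain ⟨y, hy⟩ := σ.surjective (Sum.inl b₁)
    rcases y with y | u
    · refine ⟨y, ?_⟩
      have h1 : y ≠ b₁ := by rintro rfl; simp [hb₁] at hy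
      have h2 : y ≠ b₂ := by rintro rfl; simp [hb₂] at hy
      rw [hσ₁ _ (by simpa using h1) (by simpa using h2), hσn, hy, hτ₁]
      rwa [← Equiv.Perm.sameCycle_apply_right, hy]
    · exact (h.not_start_final hy hb₁).elim
  have hz₁b₂ : σ₁.SameCycle z₁ (Sum.inl b₂) := by
    rw [← Equiv.Perm.sameCycle_apply_right, hσ₁b₂]
  -- The path of `σ₁` must be represented by `b₂`, the only cluster that both `σ₁` and `D` move.
  -- Then `D` fixes all other representatives, and `s` serves for both factors.
  obtain ⟨s, hs, hinj, hcov⟩ := Equiv.Perm.exists_transversal σ₁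
    (fun e => (∃ i i', e = Sum.inl i ∧ σ₁ (Sum.inl i') = Sum.inl i) ∧
      (σ₁.SameCycle z₁ e → e = Sum.inl b₂)) (by
    intro x hx
    by_cases hzx : σ₁.SameCycle z₁ x
    · obtain ⟨y, hy⟩ := hpred
      exact ⟨Sum.inl b₂, hz₁b₂.symm.trans hzx, ⟨b₂, y, rfl, hy⟩, fun _ => rfl⟩
    · refine ⟨x, .refl _ _, ?_, fun h => (hzx h).elim⟩
      have hr : ∀ u, σ₁.SameCycle (Sum.inr u) x → False := by
        intro u hu
        cases u
        · exact hzx hu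
        · exact hx (hu.apply_eq_self_iff.1 hσ₁z₂)
      obtain ⟨y, hy⟩ := σ₁.surjective x
      have hyx : σ₁.SameCycle y x := by
        rw [← hy, Equiv.Perm.sameCycle_apply_right]
      rcases x with i | u
      · rcases y with i' | u
        · exact ⟨i, i', rfl, hy⟩
        · exact (hr u hyx).elim
      · exact (hr u (.refl _ _)).elim)
  have hb₂s : (Sum.inl b₂ : Fin k ⊕ Bool) ∈ s := by
    obtain ⟨e, he, heb⟩ := hcov (Sum.inl b₂) (by rw [hσ₁b₂]; simp [hz₁])
    rwa [(hs e he).1.2 (hz₁b₂.trans heb.symm)] at he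
  have hDs : ∀ e ∈ s, e ≠ Sum.inl b₂ → D e = e := by
    intro e he hne
    have h1 : e ≠ Sum.inl b₁ := by
      rintro rfl
      exact (hs _ he).2 hσ₁b₁
    refine hD e h1 fun h2 => (hs e he).2 ?_
    rw [hσ₁ e h1 hne, hσ' e h2, hτ e h1 hne]
  have hσmv : ∀ x, σ.SameCycle z₂ x → σ x ≠ x := fun x hx h' =>
    hmv true (hx.apply_eq_self_iff.2 h')
  -- `D` is a single cycle: `τ` joins the fixed point `b₁` of `E` to the cycle of `b₂`.
  have hDcyc : ∀ x y, D x ≠ x → D y ≠ y → D.SameCycle x y := by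
    intro x y hx hy
    have hinv : D = (τ * E⁻¹)⁻¹ := by
      rw [mul_inv_rev, inv_inv, Equiv.swap_inv]
    have hmvd : ∀ z, D z ≠ z → (τ * E⁻¹) z ≠ z := by
      intro z hz hz'
      rw [hinv] at hz
      exact hz (Equiv.Perm.inv_eq_iff_eq.2 hz'.symm)
    have hEcyc : E.IsCycle := Equiv.Perm.isCycle_cycleOf σ (hmv true)
    have hEb : E (Sum.inl b₂) ≠ Sum.inl b₂ := by
      rw [hE _ hz₂b]; exact hσmv _ hz₂b
    rw [hinv, Equiv.Perm.sameCycle_inv]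
    refine Equiv.Perm.sameCycle_mul_of_transversal (s := {Sum.inl b₁, Sum.inl b₂})
      (Equiv.Perm.isCycleOn_swap (by simpa using hne)) (fun z hz => ?_) (fun v hv w hw hvw => ?_)
      (fun z hz => ⟨Sum.inl b₂, by simp, ?_⟩) (hmvd x hx) (hmvd y hy)
    · simp only [Set.mem_insert_iff, Set.mem_singleton_iff, not_or] at hz
      exact hτ z hz.1 hz.2
    · rw [Equiv.Perm.sameCycle_inv] at hvw
      rcases hv with rfl | rfl <;> rcases hw with rfl | rfl
      · rfl
      · exact hvw.eq_of_left (hEn _ hb₁n)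
      · exact hvw.eq_of_right (hEn _ hb₁n)
      · rfl
    · rw [Equiv.Perm.sameCycle_inv]
      exact hEcyc.sameCycle hEb fun h => hz (Equiv.Perm.inv_eq_iff_eq.2 h.symm)
  have hσb : ∀ v w, σ (Sum.inl v) = Sum.inl w →
      (Sum.inl v : Fin k ⊕ Bool) ≠ Sum.inl b₁ ∧ (Sum.inl v : Fin k ⊕ Bool) ≠ Sum.inl b₂ := by
    intro v w hvw
    constructor
    · intro h; rw [h, hb₁] at hvw; simp at hvw
    · intro h; rw [h, hb₂] at hvw; simp at hvw
  refine MovesAlong.exists_two_steps (D := D) (σ₁ := σ₁) (L := L) ?_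
    (fun e he => (hs e he).1.1) (fun e he => (hs e he).2) hinj hcov
    (fun x hx y hy hxy => ?_) (fun x hx => ⟨_, hb₂s, hDcyc _ _ ?_ hx⟩) (fun j hj => ?_)
    (fun v w hvw hne' => ?_) ⟨true, hσ₁z₂⟩ ⟨false, hD _ (by simp) hz₁n⟩ (fun u i hi => ?_) hc
    (h.isAdmissible hc hc' hm) (fun i u hi => ?_) (fun i u hi => ?_)
  · rw [hprod]
    refine ⟨hm.off, fun j hj => ?_, hm.inj, fun v w hvw hne' => ?_⟩
    · have h1 := hm.on j hj
      rw [Equiv.Perm.mul_apply, hτ _ (hσb _ _ h1).1 (hσb _ _ h1).2, h1]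
    · rw [Equiv.Perm.mul_apply] at hvw
      by_cases h1 : v = b₁
      · rw [h1, hτ₁, hb₂] at hvw; simp at hvw
      · by_cases h2 : v = b₂
        · rw [h2, hτ₂, hb₁] at hvw; simp at hvw
        · rw [hτ _ (by simpa using h1) (by simpa using h2)] at hvw
          exact hm.cover v w hvw hne'
  · by_cases h1 : x = Sum.inl b₂
    · by_cases h2 : y = Sum.inl b₂
      · rw [h1, h2]
      · exact hxy.eq_of_right (hDs y hy h2)
    · exact hxy.eq_of_left (hDs x hx h1)
  · rw [Equiv.Perm.mul_apply, hτ₂, hEn _ hb₁n]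
    simpa using hne
  · have h1 := hm.on j hj
    rw [hσ₁ _ (hσb _ _ h1).1 (hσb _ _ h1).2]
    rcases hσor (Sum.inl (c j)) with h2 | h2
    · rw [h2]; exact hτl _
    · rw [h2, h1]; exact hτl _
  · have hv₁ : (Sum.inl v : Fin k ⊕ Bool) ≠ Sum.inl b₁ := by
      intro h
      rw [h, hσ₁b₁, ← h] at hvw
      exact hne' (Sum.inl_injective hvw)
    have hv₂ : (Sum.inl v : Fin k ⊕ Bool) ≠ Sum.inl b₂ := by
      intro h
      rw [h, hσ₁b₂] at hvw
      simp [hz₁] at hvw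
    rw [hσ₁ _ hv₁ hv₂] at hvw
    rcases hσor (Sum.inl v) with h2 | h2
    · rw [h2, hτ _ hv₁ hv₂] at hvw
      exact (hne' (Sum.inl_injective hvw)).elim
    · rw [hprod, Equiv.Perm.mul_apply, hτ _ hv₁ hv₂]
      rcases hσv : σ (Sum.inl v) with w' | u
      · refine ⟨w', rfl, fun hvw' => ?_⟩
        rw [h2, hσv, ← hvw', hτ _ hv₁ hv₂] at hvw
        exact hne' (Sum.inl_injective hvw)
      · rw [h2, hσv, hτr] at hvw
        simp at hvw
  · cases u
    · rw [← hi, show σ₁ (Sum.inr false) = Sum.inl a from hσ₁z₁]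
      refine hD _ (by simpa using hab₁) ?_
      rwa [← ha, Equiv.Perm.sameCycle_apply_right]
    · rw [show σ₁ (Sum.inr true) = Sum.inr true from hσ₁z₂] at hi
      simp at hi
  · refine lt_of_lt_of_le ?_ (hc' i).2
    by_cases h1 : i = b₁
    · exact h1 ▸ h.final b₁ _ hb₁
    by_cases h2 : i = b₂
    · exact h2 ▸ h.final b₂ _ hb₂
    rw [hσ₁ _ (by simpa using h1) (by simpa using h2)] at hi
    have h3 : σ' (Sum.inl i) = Sum.inr u := τ.injective (by rw [hi, hτr])
    rcases hσor (Sum.inl i) with h4 | h4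
    · rw [h4] at h3; simp at h3
    · exact h.final i u (h4 ▸ h3)
  · refine lt_of_le_of_lt (hc' i).1 ?_
    cases u
    · rw [show σ₁ (Sum.inr false) = Sum.inl a from hσ₁z₁] at hi
      exact Sum.inl_injective hi ▸ h.start a _ ha
    · rw [show σ₁ (Sum.inr true) = Sum.inr true from hσ₁z₂] at hi
      simp at hi

end IsLayer

/-! ### Decrease of the degrees and of the total excess -/

theorem outDeg_add_of_toward {c c₂ c' : Fin n → Fin k} (h : ∀ j, c₂ j = c j ∨ c₂ j = c' j)
    (i : Fin k) : outDeg c₂ c' i + outDeg c c₂ i = outDeg c c' i := by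
  unfold outDeg
  -- A moved item is already at its target, so the items still to move and those moved partition the
  -- original ones.
  rw [← Finset.card_union_of_disjoint]
  · congr 1
    ext j
    have := h j
    simp only [Finset.mem_union, Finset.mem_filter, Finset.mem_univ, true_and]
    grind
  · rw [Finset.disjoint_left]
    intro j
    have := h j
    simp only [Finset.mem_filter, Finset.mem_univ, true_and]
    grind

theorem inDeg_add_of_toward {c c₂ c' : Fin n → Fin k} (h : ∀ j, c₂ j = c j ∨ c₂ j = c' j)
    (i : Fin k) : inDeg c₂ c' i + inDeg c c₂ i = inDeg c c' i := by
  unfold inDeg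
  rw [← Finset.card_union_of_disjoint]
  · congr 1
    ext j
    have := h j
    simp only [Finset.mem_union, Finset.mem_filter, Finset.mem_univ, true_and]
    grind
  · rw [Finset.disjoint_left]
    intro j
    have := h j
    simp only [Finset.mem_filter, Finset.mem_univ, true_and]
    grind

namespace IsLayer

variable {c c' c₂ : Fin n → Fin k} {σ : Equiv.Perm (Fin k ⊕ Bool)} {L : Finset (Fin n)}

/-- A layer lowers the degrees of all clusters of maximal degree through which it passes. -/
theorem degrees_lt (h : IsLayer c c' σ) (hm : MovesAlong σ L c c₂)
    (ht : ∀ j, c₂ j = c j ∨ c₂ j = c' j) {i : Fin k} {Δ : ℕ} (hout : outDeg c c' i ≤ Δ)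
    (hin : inDeg c c' i ≤ Δ)
    (hfix : σ (Sum.inl i) = Sum.inl i → outDeg c c' i < Δ ∧ inDeg c c' i < Δ) :
    outDeg c₂ c' i < Δ ∧ inDeg c₂ c' i < Δ := by
  have h1 := outDeg_add_of_toward ht i
  have h2 := inDeg_add_of_toward ht i
  have h3 := clusterSize_add_outDeg c c' i
  constructor
  · rcases hi : σ (Sum.inl i) with w | u
    · by_cases hw : i = w
      · subst hw
        have := hfix hi
        omega
      · have : 0 < outDeg c c₂ i := hm.card_source_pos hi hw
        omega
    -- No item needs to leave a cluster where a path ends: it has to grow, so its out-degree is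
    -- below its in-degree, hence below `Δ`.
    · have := h.final i u hi
      omega
  · obtain ⟨x, hx⟩ := σ.surjective (Sum.inl i)
    rcases x with w | u
    · by_cases hw : w = i
      · subst hw
        have := hfix hx
        omega
      · obtain ⟨j, rfl, hj⟩ := hm.exists_source hx hw
        have : 0 < inDeg c c₂ i := Finset.card_pos.2 ⟨j, by simp [hj, Ne.symm hw]⟩
        omega
    · have := h.start i u hx
      omega

/-- Each slack node through which a layer passes lowers the total excess. -/
theorem totalExcess_add_le (h : IsLayer c c' σ) (hm : MovesAlong σ L c c₂) :
    totalExcess c₂ c' + #{u | σ (Sum.inr u) ≠ Sum.inr u} ≤ totalExcess c c' := by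
  have hcard : #{u | σ (Sum.inr u) ≠ Sum.inr u} = ∑ i, #{u | σ (Sum.inr u) = Sum.inl i} := by
    rw [← Finset.card_biUnion]
    · congr 1
      ext u
      simp only [Finset.mem_filter, Finset.mem_univ, true_and, Finset.mem_biUnion]
      constructor
      · intro hu
        rcases hx : σ (Sum.inr u) with i | u'
        · exact ⟨i, rfl⟩
        · have := h.slack u u' hx
          subst this
          exact (hu hx).elim
      · rintro ⟨i, hi⟩
        simp [hi]
    · intro i _ i' _ hne
      rw [Function.onFun, Finset.disjoint_left]
      intro u
      simp only [Finset.mem_filter, Finset.mem_univ, true_and]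
      intro h1 h2
      exact hne (Sum.inl_injective (h1.symm.trans h2))
  rw [hcard]
  unfold totalExcess
  rw [← Finset.sum_add_distrib]
  refine Finset.sum_le_sum fun i _ => ?_
  by_cases hs : ∃ u, σ (Sum.inr u) = Sum.inl i
  · obtain ⟨u, hu⟩ := hs
    have h1 : #{u | σ (Sum.inr u) = Sum.inl i} ≤ 1 := by
      rw [Finset.card_le_one]
      simp only [Finset.mem_filter, Finset.mem_univ, true_and]
      intro a ha b hb
      exact Sum.inr_injective (σ.injective (ha.trans hb.symm))
    have h2 := h.start i u hu
    have h3 := clusterSize_add_outDeg c c₂ i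
    have h4 : inDeg c c₂ i = 0 := by
      rw [inDeg, Finset.card_eq_zero, Finset.filter_eq_empty_iff]
      rintro j - ⟨hj, rfl⟩
      have := hm.on j (hm.mem_of_ne hj)
      rw [← hu] at this
      simpa using σ.injective this
    have h5 : 0 < outDeg c c₂ i := by
      rcases hi : σ (Sum.inl i) with w | u'
      · refine hm.card_source_pos hi fun hw => ?_
        subst hw
        simpa using σ.injective (hu.trans hi.symm)
      · exact (h.not_start_final hu hi).elim
    omega
  · have h0 : #{u | σ (Sum.inr u) = Sum.inl i} = 0 := by
      rw [Finset.card_eq_zero, Finset.filter_eq_empty_iff]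
      exact fun u _ hu => hs ⟨u, hu⟩
    -- Where no path starts the excess cannot increase: a gain of size occurs only at the end of a
    -- path, where the cluster was too small.
    rw [h0]
    rcases hi : σ (Sum.inl i) with w | u
    · have := hm.clusterSize_le hi
      omega
    · have h1 := h.final i u hi
      have h2 := hm.clusterSize_le_add_one i
      omega

/-- A single cycle of a layer, unlike the whole layer, can be carried out in one circuit step when
it avoids a slack node. -/
theorem cycleOf (h : IsLayer c c' σ) (x : Fin k ⊕ Bool) [DecidableRel σ.SameCycle] :
    IsLayer c c' (σ.cycleOf x) := by
  have hor : ∀ y, σ.cycleOf x y = σ y ∨ σ.cycleOf x y = y := by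
    intro y
    by_cases hy : σ.SameCycle x y
    · exact Or.inl hy.cycleOf_apply
    · exact Or.inr (Equiv.Perm.cycleOf_apply_of_not_sameCycle hy)
  refine ⟨fun i i' hi hne => ?_, fun i u hi => ?_, fun i u hi => ?_, fun u u' hu => ?_⟩
  · rcases hor (Sum.inl i) with h1 | h1 <;> rw [h1] at hi
    · exact h.arc i i' hi hne
    · exact (hne (Sum.inl_injective hi)).elim
  · rcases hor (Sum.inl i) with h1 | h1 <;> rw [h1] at hi
    · exact h.final i u hi
    · simp at hi
  · rcases hor (Sum.inr u) with h1 | h1 <;> rw [h1] at hi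
    · exact h.start i u hi
    · simp at hi
  · rcases hor (Sum.inr u) with h1 | h1 <;> rw [h1] at hu
    · exact h.slack u u' hu
    · exact Sum.inr_injective hu

end IsLayer

theorem eq_of_outDeg_eq_zero {c c' : Fin n → Fin k} (h : ∀ i, outDeg c c' i = 0) : c' = c := by
  funext j
  by_contra hj
  have : 0 < outDeg c c' (c j) := Finset.card_pos.2 ⟨j, by simp [hj]⟩
  exact this.ne' (h _)

/-! ### Circuit walks by induction on the maximal degree -/

/-- Two circuit steps for each unit of the maximal degree suffice. -/
theorem withinSteps_two_mul {κp κm : Fin k → ℕ} {c' : Fin n → Fin k}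
    (hc' : IsAdmissible κp κm c') (Δ : ℕ) :
    ∀ c : Fin n → Fin k, IsAdmissible κp κm c → (∀ i, outDeg c c' i ≤ Δ) →
      (∀ i, inDeg c c' i ≤ Δ) → totalExcess c c' ≤ 2 * Δ → WithinSteps κp κm c c' (2 * Δ) := by
  induction Δ with
  | zero =>
    intro c _ hout _ _
    rw [eq_of_outDeg_eq_zero fun i => Nat.le_zero.1 (hout i)]
    exact .refl _ _ _ _
  | succ Δ ih =>
    intro c hc hout hin hP
    obtain ⟨σ, hσ, hfix, hs₁, hs₂, hsep⟩ := exists_isLayer Δ.succ_pos hout hin hP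
    obtain ⟨L, c₂, hm, ht⟩ := hσ.exists_movesAlong
    have hdeg := fun i => hσ.degrees_lt hm ht (hout i) (hin i) (hfix i)
    have hstep : ∃ c₁, StepOrEq κp κm c c₁ ∧ StepOrEq κp κm c₁ c₂ := by
      by_cases hs : ∃ u, σ (Sum.inr u) = Sum.inr u
      · exact hσ.exists_two_steps_of_slack hc hc' hm hs
      · push Not at hs
        exact hσ.exists_two_steps_of_not_sameCycle hc hc' hm hs hsep
    -- The excess must shrink only if it is `2 * Δ + 1` or `2 * Δ + 2`. The layer then moves at
    -- least one slack node, or both, respectively.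
    have hP₂ : totalExcess c₂ c' ≤ 2 * Δ := by
      have hle := hσ.totalExcess_add_le hm
      rcases Nat.lt_or_ge (totalExcess c c' + 1) (2 * (Δ + 1)) with h1 | h1
      · omega
      · rcases Nat.lt_or_ge (totalExcess c c') (2 * (Δ + 1)) with h2 | h2
        · have : 0 < #{u | σ (Sum.inr u) ≠ Sum.inr u} :=
            Finset.card_pos.2 ⟨false, by simpa using hs₁ h1⟩
          omega
        · have : #{u | σ (Sum.inr u) ≠ Sum.inr u} = 2 := by
            rw [Finset.filter_true_of_mem]
            · rfl
            · rintro (_ | _) -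
              · exact hs₁ h1
              · exact hs₂ h2
          omega
    obtain ⟨c₁, h1, h2⟩ := hstep
    exact h1.withinSteps (h2.withinSteps (ih c₂ (hσ.isAdmissible hc hc' hm)
      (fun i => Nat.lt_succ_iff.1 (hdeg i).1) (fun i => Nat.lt_succ_iff.1 (hdeg i).2) hP₂))

/-- One circuit step suffices to lower the degree of a single cluster of larger degree. -/
theorem withinSteps_two_mul_add {κp κm : Fin k → ℕ} {c' : Fin n → Fin k}
    (hc' : IsAdmissible κp κm c') (i₀ : Fin k) (Δ d : ℕ) :
    ∀ c : Fin n → Fin k, IsAdmissible κp κm c → outDeg c c' i₀ ≤ Δ + d → inDeg c c' i₀ ≤ Δ + d →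
      (∀ i ≠ i₀, outDeg c c' i ≤ Δ) → (∀ i ≠ i₀, inDeg c c' i ≤ Δ) → totalExcess c c' ≤ 2 * Δ →
      WithinSteps κp κm c c' (2 * Δ + d) := by
  classical
  induction d with
  | zero =>
    intro c hc hout₀ hin₀ hout hin hP
    refine withinSteps_two_mul hc' Δ c hc (fun i => ?_) (fun i => ?_) hP
    · by_cases hi : i = i₀
      · exact hi ▸ hout₀
      · exact hout i hi
    · by_cases hi : i = i₀
      · exact hi ▸ hin₀
      · exact hin i hi
  | succ d ih =>
    intro c hc hout₀ hin₀ hout hin hP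
    have hle : ∀ i, outDeg c c' i ≤ Δ + (d + 1) ∧ inDeg c c' i ≤ Δ + (d + 1) := by
      intro i
      by_cases hi : i = i₀
      · exact hi ▸ ⟨hout₀, hin₀⟩
      · exact ⟨(hout i hi).trans (Nat.le_add_right _ _), (hin i hi).trans (Nat.le_add_right _ _)⟩
    obtain ⟨σ, hσ, hfix, -, -, hsep⟩ := exists_isLayer (Δ := Δ + (d + 1)) (by omega)
      (fun i => (hle i).1) (fun i => (hle i).2) (by omega)
    -- Only `i₀` can have a degree above `Δ`, so the rest of the layer may be dropped. The cycle
    -- through `i₀` contains at most one slack node, as these are separated.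
    have hπ := hσ.cycleOf (Sum.inl i₀)
    obtain ⟨L, c₂, hm, ht⟩ := hπ.exists_movesAlong
    have hdeg := hπ.degrees_lt hm ht hout₀ hin₀ fun h => hfix i₀ (by
      rwa [Equiv.Perm.cycleOf_apply_self] at h)
    have hc₂ := hπ.isAdmissible hc hc' hm
    have hmv : ∀ x, σ.cycleOf (Sum.inl i₀) x ≠ x → σ.SameCycle (Sum.inl i₀) x := by
      intro x hx
      by_contra hn
      exact hx (Equiv.Perm.cycleOf_apply_of_not_sameCycle hn)
    have hstep : StepOrEq κp κm c c₂ := by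
      refine hm.stepOrEq (fun x y hx hy => ?_) ?_ hc hc₂
      · refine (Equiv.Perm.isCycle_cycleOf σ fun h => hx ?_).sameCycle hx hy
        rw [(Equiv.Perm.cycleOf_eq_one_iff σ).2 h]
        rfl
      · by_contra! hn
        exact hsep ((hmv _ (hn false)).symm.trans (hmv _ (hn true)))
    have hO := outDeg_add_of_toward ht
    have hI := inDeg_add_of_toward ht
    refine hstep.withinSteps (ih c₂ hc₂ (by omega) (by omega) (fun i hi => ?_) (fun i hi => ?_)
      ((Nat.le_add_right _ _).trans ((hπ.totalExcess_add_le hm).trans hP)))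
    · exact (Nat.le_add_right _ _).trans ((hO i).trans_le (hout i hi))
    · exact (Nat.le_add_right _ _).trans ((hI i).trans_le (hin i hi))

/-! ### The numerical bound and the diameter -/

theorem two_mul_totalExcess_le {κp κm : Fin k → ℕ} {c c' : Fin n → Fin k}
    (hc : IsAdmissible κp κm c) (hc' : IsAdmissible κp κm c') :
    2 * totalExcess c c' ≤ ∑ i, (κp i - κm i) := by
  -- Total shrinkage equals total growth, and in each cluster the two together are the change of its
  -- size.
  rw [two_mul]
  nth_rewrite 2 [totalExcess_comm]
  unfold totalExcess
  rw [← Finset.sum_add_distrib]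
  refine Finset.sum_le_sum fun i _ => ?_
  have := hc i
  have := hc' i
  omega

/-- With two clusters the excess is the change of size of either one. This covers `k = 2`, where the
term 2(k - 2) leaves no room for rounding. -/
theorem totalExcess_le_of_two_clusters {κp κm : Fin 2 → ℕ} {c c' : Fin n → Fin 2}
    (hc : IsAdmissible κp κm c) (hc' : IsAdmissible κp κm c') : totalExcess c c' ≤ κp 1 := by
  have h1 := sum_clusterSize c
  have h2 := sum_clusterSize c'
  have h3 := hc 1
  have h4 := hc' 1
  rw [Fin.sum_univ_two] at h1 h2
  rw [totalExcess, Fin.sum_univ_two]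
  omega

/-- Degrees are bounded by cluster sizes, so the first cluster alone may exceed Δ = max(κ⁺₂, ⌈P/2⌉).
The subtraction is truncated: if Δ exceeds κ⁺₁, there are no extra steps. -/
theorem withinSteps_of_admissible (hk : 2 ≤ k) {κp κm : Fin k → ℕ} (hsort : Antitone κp)
    {c c' : Fin n → Fin k} (hc : IsAdmissible κp κm c) (hc' : IsAdmissible κp κm c') :
    WithinSteps κp κm c c' (2 * max (κp ⟨1, hk⟩) ((totalExcess c c' + 1) / 2) +
      (κp ⟨0, by omega⟩ - max (κp ⟨1, hk⟩) ((totalExcess c c' + 1) / 2))) := by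
  have hout : ∀ i, outDeg c c' i ≤ κp i := fun i =>
    (Finset.card_le_card fun j hj => by
      simp only [Finset.mem_filter, Finset.mem_univ, true_and] at hj ⊢
      exact hj.2).trans (hc i).2
  have hin : ∀ i, inDeg c c' i ≤ κp i := fun i =>
    (Finset.card_le_card fun j hj => by
      simp only [Finset.mem_filter, Finset.mem_univ, true_and] at hj ⊢
      exact hj.2).trans (hc' i).2
  have h1 : ∀ i : Fin k, i ≠ ⟨0, by omega⟩ → κp i ≤ κp ⟨1, hk⟩ := by
    intro i hi
    refine hsort (Fin.le_def.2 ?_)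
    have : i.val ≠ 0 := fun h => hi (Fin.ext h)
    show 1 ≤ i.val
    omega
  have h0 := hout ⟨0, by omega⟩
  have h0' := hin ⟨0, by omega⟩
  exact withinSteps_two_mul_add hc' ⟨0, by omega⟩ _ _ c hc (by omega) (by omega)
    (fun i hi => (hout i).trans ((h1 i hi).trans (le_max_left _ _)))
    (fun i hi => (hin i).trans ((h1 i hi).trans (le_max_left _ _))) (by omega)

/-- Let w be the minimal width, attained at `i₁`, and S the sum of the other widths. Then 2P ≤ w + S
with w ≤ S and w ≤ κ⁺₂. The step count is κ⁺₁ + Δ if Δ ≤ κ⁺₁, and otherwise 2⌈P/2⌉ ≤ P + 1. For k ≥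
3 the term 2(k - 2) absorbs the rounding. -/
theorem steps_le_bound (hk : 2 ≤ k) {κp κm : Fin k → ℕ} (hle : ∀ i, κm i ≤ κp i)
    (hsort : Antitone κp) {i₁ : Fin k}
    (hi₁ : ∀ i, (κp i₁ : ℤ) - (κm i₁ : ℤ) ≤ (κp i : ℤ) - (κm i : ℤ))
    {c c' : Fin n → Fin k} (hc : IsAdmissible κp κm c) (hc' : IsAdmissible κp κm c') :
    ((2 * max (κp ⟨1, hk⟩) ((totalExcess c c' + 1) / 2) +
      (κp ⟨0, by omega⟩ - max (κp ⟨1, hk⟩) ((totalExcess c c' + 1) / 2)) : ℕ) : ℝ) ≤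
      (κp ⟨0, by omega⟩ : ℝ) + max (κp ⟨1, by omega⟩ : ℝ)
        ((1 / 2 : ℝ) * ∑ i ∈ Finset.univ.erase i₁, ((κp i : ℝ) - (κm i : ℝ))) +
        2 * ((k : ℝ) - 2) := by
  have hS : ∑ i ∈ Finset.univ.erase i₁, ((κp i : ℝ) - (κm i : ℝ)) =
      (∑ i ∈ Finset.univ.erase i₁, (κp i - κm i) : ℕ) := by
    rw [Nat.cast_sum]
    exact Finset.sum_congr rfl fun i _ => (Nat.cast_sub (hle i)).symm
  have hP := two_mul_totalExcess_le hc hc'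
  rw [← Finset.add_sum_erase _ _ (mem_univ i₁)] at hP
  have hw : ∀ i, κp i₁ - κm i₁ ≤ κp i - κm i := by
    intro i
    have := hi₁ i
    have := hle i
    omega
  have hwS : κp i₁ - κm i₁ ≤ ∑ i ∈ Finset.univ.erase i₁, (κp i - κm i) := by
    have : Nontrivial (Fin k) := Fin.nontrivial_iff_two_le.2 hk
    obtain ⟨i, hi⟩ := exists_ne i₁
    exact (hw i).trans (Finset.single_le_sum (f := fun i => κp i - κm i)
      (fun _ _ => Nat.zero_le _) (by simpa using hi))
  have h2 : k = 2 → totalExcess c c' ≤ κp ⟨1, hk⟩ := by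
    rintro rfl
    exact totalExcess_le_of_two_clusters hc hc'
  have hw₂ := hw ⟨1, hk⟩
  have hs : κp ⟨1, hk⟩ ≤ κp ⟨0, by omega⟩ := hsort (Fin.le_def.2 (Nat.zero_le 1))
  rw [hS]
  set S := ∑ i ∈ Finset.univ.erase i₁, (κp i - κm i)
  set P := totalExcess c c'
  obtain ⟨m, rfl⟩ : ∃ m, k = m + 2 := ⟨k - 2, by omega⟩
  -- Here `a` and `b` stand for the two largest upper bounds, `w` for the minimal width, `p` for the
  -- excess and `N` for the number of steps. The alternatives are the two arguments of the maximum.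
  have key : ∀ a b w p N : ℕ, b ≤ a → w ≤ b → w ≤ S → 2 * p ≤ w + S → (m = 0 → p ≤ b) →
      N = 2 * max b ((p + 1) / 2) + (a - max b ((p + 1) / 2)) →
      N ≤ a + b + 2 * m ∨ 2 * N ≤ 2 * a + S + 4 * m := by
    intro a b w p N
    omega
  rcases key _ _ _ P _ hs (hw₂.trans (Nat.sub_le _ _)) hwS hP (fun h => h2 (by omega)) rfl
    with h | h
  · have h' := (Nat.cast_le (α := ℝ)).2 h
    have := le_max_left (κp ⟨1, by omega⟩ : ℝ) ((1 / 2 : ℝ) * (S : ℝ))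
    push_cast at h' ⊢
    linarith
  · have h' := (Nat.cast_le (α := ℝ)).2 h
    have := le_max_right (κp ⟨1, by omega⟩ : ℝ) ((1 / 2 : ℝ) * (S : ℝ))
    push_cast at h' ⊢
    linarith

end

/-- The circuit diameter of a bounded-size partition polytope. The bound holds even without
`hsum` and `hslack`: two vertex-disjoint paths and any number of cycles of the difference graph
are always done in two circuit steps. -/
theorem mainTheorem2 (n k : ℕ) (hk : 2 ≤ k) (κp κm : Fin k → ℕ)
    (hle : ∀ i, κm i ≤ κp i) (hsort : Antitone κp)
    (i₁ : Fin k)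
    (hi₁ : ∀ i, (κp i₁ : ℤ) - (κm i₁ : ℤ) ≤ (κp i : ℤ) - (κm i : ℤ))
    (hsum : (n : ℤ) + (k : ℤ) - 2 < ∑ i, (κp i : ℤ))
    (hslack : ∀ i, i ≠ i₁ → κm i < κp i) :
    ∃ D : ℕ, (boundedSizePartitionSystem n k κp κm).circuitDiameter = (D : ℕ∞) ∧
      (D : ℝ) ≤ (κp ⟨0, by omega⟩ : ℝ) +
        max (κp ⟨1, by omega⟩ : ℝ)
          ((1 / 2 : ℝ) * ∑ i ∈ Finset.univ.erase i₁, ((κp i : ℝ) - (κm i : ℝ))) +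
        2 * ((k : ℝ) - 2) := by
  set bound : ℝ := (κp ⟨0, by omega⟩ : ℝ) + max (κp ⟨1, by omega⟩ : ℝ)
    ((1 / 2 : ℝ) * ∑ i ∈ Finset.univ.erase i₁, ((κp i : ℝ) - (κm i : ℝ))) +
    2 * ((k : ℝ) - 2) with hbound
  have hk' : (2 : ℝ) ≤ k := by exact_mod_cast hk
  have hb0 : 0 ≤ bound := by
    have h1 := le_max_left (κp ⟨1, by omega⟩ : ℝ)
      ((1 / 2 : ℝ) * ∑ i ∈ Finset.univ.erase i₁, ((κp i : ℝ) - (κm i : ℝ)))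
    have h2 : (0 : ℝ) ≤ κp ⟨1, by omega⟩ := Nat.cast_nonneg _
    have h3 : (0 : ℝ) ≤ κp ⟨0, by omega⟩ := Nat.cast_nonneg _
    linarith
  have hdiam : (boundedSizePartitionSystem n k κp κm).circuitDiameter ≤ (⌊bound⌋₊ : ℕ∞) := by
    refine iSup₂_le fun x hx => iSup₂_le fun y hy => ?_
    obtain ⟨c, hc, rfl⟩ := exists_assignment_of_mem_vertices hx
    obtain ⟨c', hc', rfl⟩ := exists_assignment_of_mem_vertices hy
    obtain ⟨M, hM, hwalk⟩ := withinSteps_of_admissible hk hsort hc hc'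
    have hle' : M ≤ ⌊bound⌋₊ :=
      hM.trans (Nat.le_floor (steps_le_bound hk hle hsort hi₁ hc hc'))
    exact (iInf₂_le M hwalk).trans (by exact_mod_cast hle')
  -- The bound also shows that the diameter is finite, hence a natural number.
  obtain ⟨D, hD⟩ := ENat.ne_top_iff_exists.1 (ne_top_of_le_ne_top (ENat.natCast_ne_top _) hdiam)
  refine ⟨D, hD.symm, ?_⟩
  rw [← hD] at hdiam
  have hD' : D ≤ ⌊bound⌋₊ := by exact_mod_cast hdiam
  exact (Nat.le_floor_iff hb0).1 hD'
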